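/- Let $d\ge 1$. The Drury--Arveson space $H^2_d$ is the completion of $\mathbb{C}[z]=\mathbb{C}[z_1,\dots,z_d]$ in the inner product with $\langle z^\alpha,z^\beta\rangle=\delta_{\alpha\beta}\,\frac{\alpha_1!\cdots\alpha_d!}{(\alpha_1+\dots+\alpha_d)!}$, and $S_1,\dots,S_d$ are the bounded operators on $H^2_d$ that extend multiplication by the coordinates $z_1,\dots,z_d$. For an ideal $I$ of $\mathbb{C}[z]$ put $\mathcal{F}_I=H^2_d\ominus I$ (the orthogonal complement of $I$ in $H^2_d$) and $S_i^I=P_{\mathcal{F}_I}S_i|_{\mathcal{F}_I}$. For a real number $p\ge 1$, $\mathcal{F}_I$ is called $p$-essentially normal if, for all $1\le i,j\le d$, the commutator $S_i^I (S_j^I)^*-(S_j^I)^*S_i^I$ belongs to the Schatten class $\mathcal{L}^p$, that is, its singular numbers are $p$-summable. For a homogeneous ideal $I$, let $\mathbb{H}_n$ be the space of homogeneous polynomials of degree $n$, let $I_n=I\cap\mathbb{H}_n$, and let $h_I$ be the Hilbert polynomial, that is, the polynomial with $\dim(\mathbb{H}_n\ominus I_n)=h_I(n)$ for all large $n$; put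 $\dim I=\deg h_I+1$, where the zero polynomial is given degree $-1$. Let $k\ge 1$, let $I_1,\dots,I_k$ be homogeneous ideals of $\mathbb{C}[z_1,\dots,z_d]$, and let $p\ge 1$ be a real number. (1) If $p>\max\{\dim I_1,\dots,\dim I_k\}$, each of $\mathcal{F}_{I_1},\dots,\mathcal{F}_{I_k}$ is $p$-essentially normal, and the algebraic sum $\mathcal{F}_{I_1}^\perp+\dots+\mathcal{F}_{I_k}^\perp$ is closed, then $\mathcal{F}_{I_1+\dots+I_k}$ is $p$-essentially normal. (2) If $p>\dim(I_1\cap\dots\cap I_k)$, each of $\mathcal{F}_{I_1},\dots,\mathcal{F}_{I_k}$ is $p$-essentially normal, and the algebraic sum $\mathcal{F}_{I_1}+\dots+\mathcal{F}_{I_k}$ is closed, then $\mathcal{F}_{I_1\cap\dots\cap I_k}$ is $p$-essentially normal. -/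

import Mathlib

open scoped Nat ENNReal

namespace DruryArveson

/-! ### The Drury-Arveson space and the `d`-shift -/

/-- The polynomial algebra `ℂ[z₁, …, z_d]`, as the vector space that carries the Drury-Arveson
inner product. -/
def Poly (d : ℕ) : Type := MvPolynomial (Fin d) ℂ

noncomputable instance (d : ℕ) : AddCommGroup (Poly d) :=
  inferInstanceAs (AddCommGroup (MvPolynomial (Fin d) ℂ))

noncomputable instance (d : ℕ) : Module ℂ (Poly d) :=
  inferInstanceAs (Module ℂ (MvPolynomial (Fin d) ℂ))

/-- The identity map from polynomials to `Poly d`. -/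
noncomputable def toPoly (d : ℕ) : MvPolynomial (Fin d) ℂ ≃ₗ[ℂ] Poly d :=
  LinearEquiv.refl ℂ (MvPolynomial (Fin d) ℂ)

/-- The squared norm `α₁! ⋯ α_d! / (α₁ + ⋯ + α_d)!` of the monomial `z ^ α`. -/
noncomputable def weight {d : ℕ} (α : Fin d →₀ ℕ) : ℝ :=
  ((∏ i, (α i)! : ℕ) : ℝ) / ((∑ i, α i)! : ℕ)

theorem weight_pos {d : ℕ} (α : Fin d →₀ ℕ) : 0 < weight α := by
  unfold weight
  have h : 0 < ∏ i, (α i)! := Finset.prod_pos fun i _ => Nat.factorial_pos _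
  have h' := Nat.factorial_pos (∑ i, α i)
  positivity

/-- The sesquilinear form (conjugate-linear in the first variable) with
`⟨z ^ α, z ^ β⟩ = δ_{αβ} α! / |α|!`. -/
noncomputable def polyInner {d : ℕ} (f g : MvPolynomial (Fin d) ℂ) : ℂ :=
  ∑ α ∈ f.support, star (f.coeff α) * g.coeff α * (weight α : ℂ)

theorem polyInner_eq_sum {d : ℕ} (f g : MvPolynomial (Fin d) ℂ) (s : Finset (Fin d →₀ ℕ))
    (hs : f.support ⊆ s) :
    polyInner f g = ∑ α ∈ s, star (f.coeff α) * g.coeff α * (weight α : ℂ) := by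
  refine Finset.sum_subset hs fun α _ h => ?_
  rw [MvPolynomial.notMem_support_iff.mp h]
  simp

theorem polyInner_monomial {d : ℕ} (α β : Fin d →₀ ℕ) :
    polyInner (MvPolynomial.monomial α 1) (MvPolynomial.monomial β 1) =
      if α = β then (weight α : ℂ) else 0 := by
  rw [polyInner_eq_sum _ _ {α} MvPolynomial.support_monomial_subset, Finset.sum_singleton]
  simp only [MvPolynomial.coeff_monomial, if_true, eq_comm (a := β)]
  split_ifs <;> simp

theorem polyInner_self {d : ℕ} (f : MvPolynomial (Fin d) ℂ) :
    polyInner f f = ((∑ α ∈ f.support, ‖f.coeff α‖ ^ 2 * weight α : ℝ) : ℂ) := by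
  unfold polyInner
  push_cast
  refine Finset.sum_congr rfl fun α _ => ?_
  have h := Complex.conj_mul' (f.coeff α)
  rw [← h]
  rfl

theorem polyInner_symm {d : ℕ} (f g : MvPolynomial (Fin d) ℂ) :
    star (polyInner g f) = polyInner f g := by
  classical
  rw [polyInner_eq_sum g f (f.support ∪ g.support) Finset.subset_union_right,
    polyInner_eq_sum f g (f.support ∪ g.support) Finset.subset_union_left, star_sum]
  refine Finset.sum_congr rfl fun α _ => ?_
  simp [mul_comm]

theorem polyInner_add_left {d : ℕ} (f g h : MvPolynomial (Fin d) ℂ) :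
    polyInner (f + g) h = polyInner f h + polyInner g h := by
  classical
  rw [polyInner_eq_sum f h (f.support ∪ g.support) Finset.subset_union_left,
    polyInner_eq_sum g h (f.support ∪ g.support) Finset.subset_union_right,
    polyInner_eq_sum (f + g) h (f.support ∪ g.support) MvPolynomial.support_add,
    ← Finset.sum_add_distrib]
  refine Finset.sum_congr rfl fun α _ => ?_
  rw [MvPolynomial.coeff_add, star_add]
  ring

theorem polyInner_smul_left {d : ℕ} (f g : MvPolynomial (Fin d) ℂ) (r : ℂ) :
    polyInner (r • f) g = star r * polyInner f g := by
  rw [polyInner_eq_sum (r • f) g f.support MvPolynomial.support_smul, polyInner, Finset.mul_sum]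
  refine Finset.sum_congr rfl fun α _ => ?_
  rw [MvPolynomial.coeff_smul, smul_eq_mul, star_mul']
  ring

theorem polyInner_definite {d : ℕ} (f : MvPolynomial (Fin d) ℂ) (h : polyInner f f = 0) :
    f = 0 := by
  rw [polyInner_self, Complex.ofReal_eq_zero, Finset.sum_eq_zero_iff_of_nonneg
    fun α _ => mul_nonneg (sq_nonneg _) (weight_pos α).le] at h
  ext α
  by_contra hα
  rw [MvPolynomial.coeff_zero] at hα
  rcases mul_eq_zero.mp (h α (MvPolynomial.mem_support_iff.mpr hα)) with h0 | h0
  · exact hα (norm_eq_zero.mp ((pow_eq_zero_iff two_ne_zero).mp h0))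
  · exact (weight_pos α).ne' h0

theorem polyInner_re_nonneg {d : ℕ} (f : MvPolynomial (Fin d) ℂ) : 0 ≤ (polyInner f f).re := by
  rw [polyInner_self, Complex.ofReal_re]
  exact Finset.sum_nonneg fun α _ => mul_nonneg (sq_nonneg _) (weight_pos α).le

/-- The Drury-Arveson inner product on the polynomials. -/
@[reducible]
noncomputable def innerCore (d : ℕ) : InnerProductSpace.Core ℂ (Poly d) where
  inner f g := polyInner ((toPoly d).symm f) ((toPoly d).symm g)
  conj_inner_symm f g := polyInner_symm _ _
  re_inner_nonneg f := polyInner_re_nonneg _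
  add_left f g h := by rw [map_add, polyInner_add_left]
  smul_left f g r := by
    rw [map_smul, polyInner_smul_left]
    rfl
  definite f h := (toPoly d).symm.map_eq_zero_iff.mp (polyInner_definite _ h)

noncomputable instance (d : ℕ) : NormedAddCommGroup (Poly d) :=
  (innerCore d).toNormedAddCommGroup

noncomputable instance (d : ℕ) : InnerProductSpace ℂ (Poly d) :=
  InnerProductSpace.ofCore (innerCore d).toCore

/-- The Drury-Arveson space `H²_d`, the completion of the polynomials. -/
abbrev Space (d : ℕ) : Type := UniformSpace.Completion (Poly d)

/-- The inclusion of the polynomials in `H²_d`. -/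
noncomputable def incl (d : ℕ) : MvPolynomial (Fin d) ℂ →ₗ[ℂ] Space d :=
  (UniformSpace.Completion.toComplL (𝕜 := ℂ) (E := Poly d)).toLinearMap ∘ₗ (toPoly d).toLinearMap

/-- Multiplication by `z_i` on the polynomials. -/
noncomputable def mulX {d : ℕ} (i : Fin d) : Poly d →ₗ[ℂ] Poly d :=
  (toPoly d).toLinearMap ∘ₗ LinearMap.mulLeft ℂ (MvPolynomial.X i) ∘ₗ (toPoly d).symm.toLinearMap

theorem weight_single_add_le {d : ℕ} (i : Fin d) (α : Fin d →₀ ℕ) :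
    weight (Finsupp.single i 1 + α) ≤ weight α := by
  have hprod : ∏ j, ((Finsupp.single i 1 + α : Fin d →₀ ℕ) j)! = (α i + 1) * ∏ j, (α j)! := by
    rw [← Finset.mul_prod_erase _ _ (Finset.mem_univ i),
      ← Finset.mul_prod_erase _ (fun j => (α j)!) (Finset.mem_univ i)]
    have h : ∏ j ∈ Finset.univ.erase i, ((Finsupp.single i 1 + α : Fin d →₀ ℕ) j)! =
        ∏ j ∈ Finset.univ.erase i, (α j)! := by
      refine Finset.prod_congr rfl fun j hj => ?_
      rw [Finsupp.add_apply, Finsupp.single_eq_of_ne (Finset.ne_of_mem_erase hj), zero_add]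
    rw [h, Finsupp.add_apply, Finsupp.single_eq_same, add_comm 1, Nat.factorial_succ, mul_assoc]
  have hsum : ∑ j, (Finsupp.single i 1 + α : Fin d →₀ ℕ) j = ∑ j, α j + 1 := by
    simp [Finset.sum_add_distrib, Finsupp.single_apply, add_comm]
  have hle : α i ≤ ∑ j, α j :=
    Finset.single_le_sum (f := fun j => α j) (fun _ _ => Nat.zero_le _) (Finset.mem_univ i)
  unfold weight
  rw [hprod, hsum, Nat.factorial_succ, div_le_div_iff₀
    (by exact_mod_cast Nat.mul_pos (Nat.succ_pos _) (Nat.factorial_pos _))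
    (by exact_mod_cast Nat.factorial_pos _)]
  norm_cast
  nlinarith [Nat.mul_le_mul_right ((∏ j, (α j)!) * (∑ j, α j)!) (Nat.succ_le_succ hle)]

theorem norm_sq_eq {d : ℕ} (f : MvPolynomial (Fin d) ℂ) :
    ‖toPoly d f‖ ^ 2 = ∑ α ∈ f.support, ‖f.coeff α‖ ^ 2 * weight α := by
  rw [InnerProductSpace.norm_sq_eq_re_inner (𝕜 := ℂ)]
  change Complex.re (polyInner f f) = _
  rw [polyInner_self, Complex.ofReal_re]

theorem norm_mulX_le {d : ℕ} (i : Fin d) (f : Poly d) : ‖mulX i f‖ ≤ 1 * ‖f‖ := by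
  obtain ⟨g, rfl⟩ := (toPoly d).surjective f
  have h : mulX i (toPoly d g) = toPoly d (MvPolynomial.X i * g) := rfl
  rw [one_mul, h]
  refine le_of_sq_le_sq ?_ (norm_nonneg _)
  rw [norm_sq_eq, norm_sq_eq, MvPolynomial.support_X_mul, Finset.sum_map]
  refine Finset.sum_le_sum fun α _ => ?_
  rw [addLeftEmbedding_apply, MvPolynomial.coeff_X_mul]
  exact mul_le_mul_of_nonneg_left (weight_single_add_le i α) (sq_nonneg _)

/-- The `i`-th component `S_i` of the `d`-shift: the bounded operator on `H²_d` that extends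
multiplication by `z_i` on the polynomials. -/
noncomputable def shift {d : ℕ} (i : Fin d) : Space d →L[ℂ] Space d :=
  ContinuousLinearMap.extend
    ((UniformSpace.Completion.toComplL (𝕜 := ℂ) (E := Poly d)).comp
      ((mulX i).mkContinuous 1 (norm_mulX_le i)))
    (UniformSpace.Completion.toComplL (𝕜 := ℂ) (E := Poly d))

theorem shift_incl {d : ℕ} (i : Fin d) (f : MvPolynomial (Fin d) ℂ) :
    shift i (incl d f) = incl d (MvPolynomial.X i * f) :=
  ContinuousLinearMap.extend_eq _
    UniformSpace.Completion.denseRange_coe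
    (UniformSpace.Completion.isUniformInducing_coe (Poly d)) (toPoly d f)

/-! ### Schatten classes -/

/-- The `n`-th singular number (counted from `0`) of a bounded operator, in the form of its
approximation number: the distance in operator norm to the operators of rank at most `n`. -/
noncomputable def singularNumber {E F : Type*} [NormedAddCommGroup E] [InnerProductSpace ℂ E]
    [NormedAddCommGroup F] [InnerProductSpace ℂ F] (T : E →L[ℂ] F) (n : ℕ) : ℝ :=
  Metric.infDist T {R : E →L[ℂ] F | R.toLinearMap.rank ≤ n}

/-- `T` belongs to the Schatten class `𝓛^p`: its singular numbers are `p`-summable. -/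
def IsSchatten {E F : Type*} [NormedAddCommGroup E] [InnerProductSpace ℂ E]
    [NormedAddCommGroup F] [InnerProductSpace ℂ F] (p : ℝ) (T : E →L[ℂ] F) : Prop :=
  Summable fun n : ℕ => singularNumber T n ^ p

/-! ### Quotient modules and essential normality -/

/-- The quotient module `𝓕_I = H²_d ⊖ I`. -/
noncomputable abbrev quotientModule {d : ℕ} (I : Ideal (MvPolynomial (Fin d) ℂ)) :
    Submodule ℂ (Space d) :=
  ((I.restrictScalars ℂ).map (incl d))ᗮ

/-- The compression `S_i^I` of the shift `S_i` to `𝓕_I`. -/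
noncomputable def compressedShift {d : ℕ} (I : Ideal (MvPolynomial (Fin d) ℂ)) (i : Fin d) :
    quotientModule I →L[ℂ] quotientModule I :=
  (quotientModule I).orthogonalProjectionOnto ∘L shift i ∘L (quotientModule I).subtypeL

/-- `𝓕_I` is `p`-essentially normal: all commutators `[S_i^I, (S_j^I)^*]` belong to `𝓛^p`. -/
def IsEssentiallyNormal {d : ℕ} (p : ℝ) (I : Ideal (MvPolynomial (Fin d) ℂ)) : Prop :=
  ∀ i j : Fin d, IsSchatten p
    (compressedShift I i ∘L ContinuousLinearMap.adjoint (compressedShift I j) -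
      ContinuousLinearMap.adjoint (compressedShift I j) ∘L compressedShift I i)

/-! ### Homogeneous ideals and their dimension -/

attribute [local instance] MvPolynomial.gradedAlgebra

/-- The ideal `I` is homogeneous for the grading by total degree. -/
def IsHomogeneousIdeal {d : ℕ} (I : Ideal (MvPolynomial (Fin d) ℂ)) : Prop :=
  I.IsHomogeneous (MvPolynomial.homogeneousSubmodule (Fin d) ℂ)

/-- The space `ℍ_n ⊖ I_n`, where `ℍ_n` is the space of homogeneous polynomials of degree `n`
and `I_n = I ∩ ℍ_n`. -/
noncomputable def degreePart {d : ℕ} (I : Ideal (MvPolynomial (Fin d) ℂ)) (n : ℕ) :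
    Submodule ℂ (Poly d) :=
  (MvPolynomial.homogeneousSubmodule (Fin d) ℂ n).map (toPoly d).toLinearMap ⊓
    ((I.restrictScalars ℂ ⊓ MvPolynomial.homogeneousSubmodule (Fin d) ℂ n).map
      (toPoly d).toLinearMap)ᗮ

/-- `h` is the Hilbert polynomial of `I`: `dim (ℍ_n ⊖ I_n) = h n` for all large `n`. -/
def IsHilbertPolynomial {d : ℕ} (I : Ideal (MvPolynomial (Fin d) ℂ)) (h : Polynomial ℚ) : Prop :=
  ∀ᶠ n : ℕ in Filter.atTop, h.eval (n : ℚ) = Module.finrank ℂ (degreePart I n)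

/-- The dimension of `I`: the degree of its Hilbert polynomial plus one, where the zero polynomial
has degree `-1`. A homogeneous ideal has exactly one Hilbert polynomial, so that the infimum ranges
over one value. -/
noncomputable def idealDim {d : ℕ} (I : Ideal (MvPolynomial (Fin d) ℂ)) : ℕ∞ :=
  ⨅ (h : Polynomial ℚ) (_ : IsHilbertPolynomial I h),
    if h = 0 then 0 else (h.natDegree : ℕ∞) + 1

end DruryArveson

/-! Each `𝓕_I` is invariant under all `S_j^*`. With `P` the projection to `𝓕_I` and `X_i = (1 - P)
S_i P`, this gives `[S_i^I, (S_j^I)^*] = P [S_i, S_j^*] P + X_j^* X_i`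
(`commutator_compression_eq`). On monomials of degree `n` the commutator `[S_i, S_j^*]` has size
`O(1 / (n + 1))`, and the part of `𝓕_I` in degrees below `N` has dimension `O(N ^ dim I)`, or `O(1)`
if `dim I = 0`. Hence the first term is in `𝓛^p` once `p > dim I`, and then `𝓕_I` is `p`-essentially
normal exactly when every `X_i` is in `𝓛^{2p}` (`isEssentiallyNormal_iff`).

This criterion passes to closed sums. By the open mapping theorem, a vector `y` of a closed sum of
closed subspaces satisfies `‖y‖ ≤ C ∑ ‖P_j y‖`, where `P_j` are the projections to the summands. In
(1), `𝓕` of the sum is the intersection of the `𝓕_{I_j}`; the estimate is applied to the values of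
`X_i` in the sum of the complements. In (2), `𝓕` of the intersection is the sum of the `𝓕_{I_j}`, by
homogeneity and closedness; the estimate is applied to the values of `X_i^*`. Either way the
projected vectors come from the off-diagonal parts for the `I_j`, and `IsSchatten.of_norm_le_sum`
turns the norm estimate into Schatten membership. -/

namespace DruryArveson

/-! ### Singular numbers -/

section Schatten

open ContinuousLinearMap

variable {E F G : Type*} [NormedAddCommGroup E] [InnerProductSpace ℂ E]
  [NormedAddCommGroup F] [InnerProductSpace ℂ F] [NormedAddCommGroup G] [InnerProductSpace ℂ G]

/-- `T` has norm at most `ε` on the orthogonal complement of some `n` vectors. -/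
def IsSmallOffFinset (T : E →L[ℂ] F) (n : ℕ) (ε : ℝ) : Prop :=
  ∃ t : Finset E, t.card ≤ n ∧ ∀ x, (∀ v ∈ t, inner ℂ v x = 0) → ‖T x‖ ≤ ε * ‖x‖

theorem singularNumber_nonneg (T : E →L[ℂ] F) (n : ℕ) : 0 ≤ singularNumber T n :=
  Metric.infDist_nonneg

theorem zero_mem_rank_le (n : ℕ) : (0 : E →L[ℂ] F) ∈ {R : E →L[ℂ] F | R.toLinearMap.rank ≤ n} := by
  simp

theorem singularNumber_le_norm_sub (T R : E →L[ℂ] F) {n : ℕ} (hR : R.toLinearMap.rank ≤ n) :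
    singularNumber T n ≤ ‖T - R‖ := by
  rw [← dist_eq_norm]
  exact Metric.infDist_le_dist_of_mem hR

theorem singularNumber_antitone (T : E →L[ℂ] F) : Antitone (singularNumber T) := by
  intro m n hmn
  refine Metric.infDist_le_infDist_of_subset (fun R hR => ?_) ⟨0, zero_mem_rank_le m⟩
  have hR' : R.toLinearMap.rank ≤ m := hR
  exact hR'.trans (Nat.cast_le.mpr hmn)

/-- An operator `R` of rank at most `n` vanishes on the complement of the images under `R^*` of a
basis of its range; there `T` agrees with `T - R`. -/
theorem isSmallOffFinset_of_singularNumber_lt [CompleteSpace E] [CompleteSpace F] {T : E →L[ℂ] F}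
    {n : ℕ} {ε : ℝ} (h : singularNumber T n < ε) : IsSmallOffFinset T n ε := by
  classical
  obtain ⟨R, hR, hTR⟩ := (Metric.infDist_lt_iff ⟨0, zero_mem_rank_le n⟩).mp h
  have hR' : Module.rank ℂ R.range ≤ n := hR
  have hfin : FiniteDimensional ℂ R.range :=
    Module.rank_lt_aleph0_iff.mp (hR'.trans_lt Cardinal.natCast_lt_aleph0)
  let b := Module.finBasis ℂ R.range
  refine ⟨Finset.univ.image fun i => adjoint R (b i : F), ?_, fun x hx => ?_⟩
  · refine Finset.card_image_le.trans ?_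
    rw [Finset.card_univ, Fintype.card_fin]
    exact Module.finrank_le_of_rank_le hR'
  · have hRx : R x = 0 := by
      let y : R.range := ⟨R x, x, rfl⟩
      have hy : y = 0 := by
        refine InnerProductSpace.ext_inner_left_basis (𝕜 := ℂ) b fun i => ?_
        have := hx _ (Finset.mem_image_of_mem _ (Finset.mem_univ i))
        rw [adjoint_inner_left] at this
        rw [inner_zero_right]
        exact this
      exact congrArg Subtype.val hy
    have : T x = (T - R) x := by simp [hRx]
    rw [this]
    refine (le_opNorm _ _).trans (mul_le_mul_of_nonneg_right ?_ (norm_nonneg _))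
    rw [← dist_eq_norm]
    exact hTR.le

/-- With `P` the projection to the span of the test vectors, `T P` is the approximant: the error `T
(1 - P)` only sees the complement. -/
theorem IsSmallOffFinset.singularNumber_le {T : E →L[ℂ] F} {n : ℕ} {ε : ℝ} (hε : 0 ≤ ε)
    (h : IsSmallOffFinset T n ε) : singularNumber T n ≤ ε := by
  obtain ⟨t, ht, hT⟩ := h
  let U := Submodule.span ℂ (t : Set E)
  refine (singularNumber_le_norm_sub T (T ∘L U.starProjection) ?_).trans ?_
  · have hrange : LinearMap.range (U.starProjection : E →ₗ[ℂ] E) = U := U.range_starProjection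
    have hrank : (U.starProjection : E →ₗ[ℂ] E).rank ≤ n := by
      rw [LinearMap.rank, hrange]
      exact (rank_span_finset_le (R := ℂ) t).trans (Nat.cast_le.mpr ht)
    have := (LinearMap.lift_rank_comp_le_right (U.starProjection : E →ₗ[ℂ] E)
      (T : E →ₗ[ℂ] F)).trans (Cardinal.lift_le.mpr hrank)
    rw [Cardinal.lift_natCast] at this
    exact Cardinal.lift_le_nat_iff.mp this
  · refine opNorm_le_bound _ hε fun x => ?_
    have : (T - T ∘L U.starProjection) x = T (x - U.starProjection x) := by simp
    rw [this]
    have hmem := U.sub_starProjection_mem_orthogonal x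
    refine (hT _ fun v hv => ?_).trans (mul_le_mul_of_nonneg_left ?_ hε)
    · exact (Submodule.mem_orthogonal _ _).mp hmem v (Submodule.subset_span hv)
    · rw [← Submodule.starProjection_orthogonal_val]
      exact Submodule.norm_starProjection_apply_le _ _

/-- If `y` is orthogonal to the images `T v`, then `z = T^* y` is orthogonal to the test vectors
`v`, and `‖z‖² = Re ⟨T z, y⟩ ≤ ε ‖z‖ ‖y‖`. -/
theorem IsSmallOffFinset.adjoint [CompleteSpace E] [CompleteSpace F] {T : E →L[ℂ] F} {n : ℕ}
    {ε : ℝ} (hε : 0 ≤ ε) (h : IsSmallOffFinset T n ε) :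
    IsSmallOffFinset (ContinuousLinearMap.adjoint T) n ε := by
  classical
  obtain ⟨t, ht, hT⟩ := h
  refine ⟨t.image T, Finset.card_image_le.trans ht, fun y hy => ?_⟩
  set z := ContinuousLinearMap.adjoint T y with hz
  have h1 : ‖T z‖ ≤ ε * ‖z‖ := hT z fun v hv => by
    rw [hz, adjoint_inner_right]
    exact hy _ (Finset.mem_image_of_mem _ hv)
  have h2 : ‖z‖ ^ 2 ≤ ‖T z‖ * ‖y‖ := by
    have : ‖z‖ ^ 2 = RCLike.re (inner ℂ (T z) y) := by
      rw [← adjoint_inner_right, ← hz, inner_self_eq_norm_sq]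
    rw [this]
    exact re_inner_le_norm _ _
  rcases (norm_nonneg z).eq_or_lt with h0 | h0
  · rw [← h0]
    positivity
  · have : ‖z‖ * ‖z‖ ≤ (ε * ‖y‖) * ‖z‖ := by nlinarith [norm_nonneg y]
    exact le_of_mul_le_mul_right this h0

theorem IsSmallOffFinset.comp [CompleteSpace E] [CompleteSpace F] {S : F →L[ℂ] G} {T : E →L[ℂ] F}
    {m n : ℕ} {ε δ : ℝ} (hε : 0 ≤ ε) (hS : IsSmallOffFinset S m ε) (hT : IsSmallOffFinset T n δ) :
    IsSmallOffFinset (S ∘L T) (m + n) (ε * δ) := by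
  classical
  obtain ⟨s, hs, hS⟩ := hS
  obtain ⟨t, ht, hT⟩ := hT
  refine ⟨s.image (ContinuousLinearMap.adjoint T) ∪ t, (Finset.card_union_le _ _).trans
    (add_le_add (Finset.card_image_le.trans hs) ht), fun x hx => ?_⟩
  have h1 : ‖S (T x)‖ ≤ ε * ‖T x‖ := hS _ fun v hv => by
    rw [← adjoint_inner_left]
    exact hx _ (Finset.mem_union_left _ (Finset.mem_image_of_mem _ hv))
  refine h1.trans ?_
  rw [mul_assoc]
  exact mul_le_mul_of_nonneg_left (hT x fun v hv => hx v (Finset.mem_union_right _ hv)) hε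

theorem singularNumber_adjoint_le [CompleteSpace E] [CompleteSpace F] (T : E →L[ℂ] F) (n : ℕ) :
    singularNumber (ContinuousLinearMap.adjoint T) n ≤ singularNumber T n :=
  le_of_forall_gt fun ε hε => by
    obtain ⟨δ, h1, h2⟩ := exists_between hε
    have h0 : 0 ≤ δ := (singularNumber_nonneg T n).trans h1.le
    exact (((isSmallOffFinset_of_singularNumber_lt h1).adjoint h0).singularNumber_le h0).trans_lt h2

theorem singularNumber_comp_le [CompleteSpace E] [CompleteSpace F] [CompleteSpace G]
    (S : F →L[ℂ] G) (T : E →L[ℂ] F) (m n : ℕ) :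
    singularNumber (S ∘L T) (m + n) ≤ singularNumber S m * singularNumber T n := by
  -- The infimum in a singular number need not be attained, so each factor gets a slack `δ` that is
  -- sent to `0`.
  have hlim : Filter.Tendsto (fun δ : ℝ => (singularNumber S m + δ) * (singularNumber T n + δ))
      (nhdsWithin 0 (Set.Ioi 0)) (nhds (singularNumber S m * singularNumber T n)) := by
    have : Continuous fun δ : ℝ => (singularNumber S m + δ) * (singularNumber T n + δ) := by
      fun_prop
    simpa using (this.tendsto 0).mono_left nhdsWithin_le_nhds
  refine ge_of_tendsto hlim ?_
  filter_upwards [self_mem_nhdsWithin] with δ hδ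
  have hδ : 0 < δ := hδ
  have hS := singularNumber_nonneg S m
  have hT := singularNumber_nonneg T n
  exact ((isSmallOffFinset_of_singularNumber_lt (lt_add_of_pos_right _ hδ)).comp (by positivity)
    (isSmallOffFinset_of_singularNumber_lt (lt_add_of_pos_right _ hδ))).singularNumber_le
    (by positivity)

theorem singularNumber_sq_le [CompleteSpace E] [CompleteSpace F] (T : E →L[ℂ] F) (n : ℕ) :
    singularNumber T n ^ 2 ≤ singularNumber (ContinuousLinearMap.adjoint T ∘L T) n :=
  le_of_forall_gt fun ε hε => by
    obtain ⟨δ, h1, h2⟩ := exists_between hε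
    have h0 : 0 ≤ δ := (singularNumber_nonneg _ n).trans h1.le
    obtain ⟨t, ht, hT⟩ := isSmallOffFinset_of_singularNumber_lt h1
    have : IsSmallOffFinset T n (√δ) := ⟨t, ht, fun x hx => by
      have h3 := hT x hx
      have h4 : ‖T x‖ ^ 2 ≤ δ * ‖x‖ ^ 2 := by
        rw [apply_norm_sq_eq_inner_adjoint_left T x]
        refine (re_inner_le_norm _ _).trans ?_
        nlinarith [norm_nonneg x]
      refine abs_le_of_sq_le_sq' ?_ (by positivity) |>.2
      rwa [mul_pow, Real.sq_sqrt h0]⟩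
    have h5 := this.singularNumber_le (Real.sqrt_nonneg _)
    calc singularNumber T n ^ 2 ≤ √δ ^ 2 := pow_le_pow_left₀ (singularNumber_nonneg _ _) h5 2
      _ = δ := Real.sq_sqrt h0
      _ < ε := h2

/-- Off the union of the test sets for the `S j`, all the `S j` are small at once, hence so is `T`.
-/
theorem singularNumber_le_sum [CompleteSpace E] {ι : Type*} [Fintype ι] {X : ι → Type*}
    [∀ j, NormedAddCommGroup (X j)] [∀ j, InnerProductSpace ℂ (X j)] [∀ j, CompleteSpace (X j)]
    (T : E →L[ℂ] F) (S : ∀ j, E →L[ℂ] X j) {C : ℝ} (hC : 0 ≤ C)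
    (h : ∀ x, ‖T x‖ ≤ C * ∑ j, ‖S j x‖) (n : ℕ) :
    singularNumber T (Fintype.card ι * n) ≤ C * ∑ j, singularNumber (S j) n := by
  classical
  have hlim : Filter.Tendsto (fun δ : ℝ => C * ∑ j, (singularNumber (S j) n + δ))
      (nhdsWithin 0 (Set.Ioi 0)) (nhds (C * ∑ j, singularNumber (S j) n)) := by
    have : Continuous fun δ : ℝ => C * ∑ j, (singularNumber (S j) n + δ) := by
      fun_prop
    simpa using (this.tendsto 0).mono_left nhdsWithin_le_nhds
  refine ge_of_tendsto hlim ?_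
  filter_upwards [self_mem_nhdsWithin] with δ hδ
  have hδ : 0 < δ := hδ
  have hS := fun j => singularNumber_nonneg (S j) n
  choose t ht hT using fun j =>
    isSmallOffFinset_of_singularNumber_lt (lt_add_of_pos_right (singularNumber (S j) n) hδ)
  refine IsSmallOffFinset.singularNumber_le
    (mul_nonneg hC (Finset.sum_nonneg fun j _ => add_nonneg (hS j) hδ.le))
    ⟨Finset.univ.biUnion t, ?_, fun x hx => ?_⟩
  · refine Finset.card_biUnion_le.trans ?_
    refine (Finset.sum_le_card_nsmul _ _ n fun j _ => ht j).trans ?_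
    simp
  · refine (h x).trans ?_
    rw [mul_assoc, Finset.sum_mul]
    refine mul_le_mul_of_nonneg_left (Finset.sum_le_sum fun j _ => ?_) hC
    exact hT j x fun v hv => hx v (Finset.mem_biUnion.mpr ⟨j, Finset.mem_univ j, hv⟩)

/-! ### Schatten classes as ideals -/

/-- Singular numbers decrease, so the one at index `k * n` bounds the `k` that start there;
repeating each term `k` times preserves summability. -/
theorem isSchatten_of_singularNumber_mul_le {T : E →L[ℂ] F} {p : ℝ} (hp : 0 ≤ p) {k : ℕ}
    (hk : 0 < k) {a : ℕ → ℝ} (ha : Summable a) (h : ∀ n, singularNumber T (k * n) ^ p ≤ a n) :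
    IsSchatten p T := by
  have : NeZero k := ⟨hk.ne'⟩
  have ha0 : ∀ n, 0 ≤ a n := fun n =>
    (Real.rpow_nonneg (singularNumber_nonneg T _) _).trans (h n)
  have hsum : Summable fun m : ℕ => a (m / k) := by
    have h1 : Summable fun x : ℕ × Fin k => a x.1 * (1 : ℝ) :=
      ha.mul_of_nonneg (g := fun _ : Fin k => (1 : ℝ)) Summable.of_finite ha0
        (fun _ => zero_le_one)
    have h2 := (Nat.divModEquiv k).summable_iff.mpr h1
    refine h2.congr fun m => ?_
    simp
  refine hsum.of_nonneg_of_le (fun m => Real.rpow_nonneg (singularNumber_nonneg T m) p)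
    fun m => ?_
  refine le_trans ?_ (h _)
  exact Real.rpow_le_rpow (singularNumber_nonneg T m)
    (singularNumber_antitone T (Nat.mul_div_le m k)) hp

/-- Pointwise domination suffices for Schatten membership. This covers sums, differences and left
multiples, and it is the form in which closedness of a sum of subspaces is used. -/
theorem IsSchatten.of_norm_le_sum [CompleteSpace E] {ι : Type*} [Fintype ι] {X : ι → Type*}
    [∀ j, NormedAddCommGroup (X j)] [∀ j, InnerProductSpace ℂ (X j)] [∀ j, CompleteSpace (X j)]
    {p : ℝ} (hp : 1 ≤ p) (T : E →L[ℂ] F) (S : ∀ j, E →L[ℂ] X j) {C : ℝ} (hC : 0 ≤ C)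
    (h : ∀ x, ‖T x‖ ≤ C * ∑ j, ‖S j x‖) (hS : ∀ j, IsSchatten p (S j)) : IsSchatten p T := by
  have hp0 : 0 ≤ p := zero_le_one.trans hp
  have hs0 := fun j n => singularNumber_nonneg (S j) n
  -- The successor keeps the multiplier positive when `ι` is empty.
  refine isSchatten_of_singularNumber_mul_le hp0 (Nat.succ_pos (Fintype.card ι))
    ((summable_sum (s := Finset.univ) fun j _ => hS j).mul_left
      (C ^ p * (Fintype.card ι : ℝ) ^ (p - 1))) fun n => ?_
  have h1 : singularNumber T ((Fintype.card ι).succ * n) ≤ C * ∑ j, singularNumber (S j) n :=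
    (singularNumber_antitone T (Nat.mul_le_mul_right n (Nat.le_succ _))).trans
      (singularNumber_le_sum T S hC h n)
  refine (Real.rpow_le_rpow (singularNumber_nonneg T _) h1 hp0).trans ?_
  rw [Real.mul_rpow hC (Finset.sum_nonneg fun j _ => hs0 j n), mul_assoc]
  refine mul_le_mul_of_nonneg_left ?_ (Real.rpow_nonneg hC p)
  exact Real.rpow_sum_le_const_mul_sum_rpow_of_nonneg Finset.univ hp fun j _ => hs0 j n

theorem IsSchatten.of_norm_le [CompleteSpace E] [CompleteSpace G] {p : ℝ} (hp : 1 ≤ p)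
    (T : E →L[ℂ] F) (S : E →L[ℂ] G) {C : ℝ} (hC : 0 ≤ C) (h : ∀ x, ‖T x‖ ≤ C * ‖S x‖)
    (hS : IsSchatten p S) : IsSchatten p T :=
  IsSchatten.of_norm_le_sum (ι := Unit) hp T (fun _ => S) hC (by simpa using h) fun _ => hS

theorem IsSchatten.add [CompleteSpace E] [CompleteSpace F] {p : ℝ} (hp : 1 ≤ p)
    {S T : E →L[ℂ] F} (hS : IsSchatten p S) (hT : IsSchatten p T) : IsSchatten p (S + T) :=
  IsSchatten.of_norm_le_sum hp _ (fun b : Bool => bif b then S else T) zero_le_one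
    (fun x => by simpa using norm_add_le (S x) (T x)) (by simp [hS, hT])

theorem IsSchatten.sub [CompleteSpace E] [CompleteSpace F] {p : ℝ} (hp : 1 ≤ p)
    {S T : E →L[ℂ] F} (hS : IsSchatten p S) (hT : IsSchatten p T) : IsSchatten p (S - T) :=
  IsSchatten.of_norm_le_sum hp _ (fun b : Bool => bif b then S else T) zero_le_one
    (fun x => by simpa using norm_sub_le (S x) (T x)) (by simp [hS, hT])

theorem IsSchatten.adjoint [CompleteSpace E] [CompleteSpace F] {p : ℝ} (hp : 0 ≤ p)
    {T : E →L[ℂ] F} (hT : IsSchatten p T) : IsSchatten p (ContinuousLinearMap.adjoint T) :=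
  Summable.of_nonneg_of_le (fun n => Real.rpow_nonneg (singularNumber_nonneg _ n) p)
    (fun n => Real.rpow_le_rpow (singularNumber_nonneg _ n) (singularNumber_adjoint_le T n) hp) hT

theorem IsSchatten.comp_left [CompleteSpace E] [CompleteSpace F] {p : ℝ} (hp : 1 ≤ p)
    (A : F →L[ℂ] G) {T : E →L[ℂ] F} (hT : IsSchatten p T) : IsSchatten p (A ∘L T) :=
  hT.of_norm_le hp _ _ (norm_nonneg A) fun x => le_opNorm A (T x)

theorem IsSchatten.comp_right [CompleteSpace E] [CompleteSpace F] [CompleteSpace G] {p : ℝ}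
    (hp : 1 ≤ p) {T : F →L[ℂ] G} (hT : IsSchatten p T) (A : E →L[ℂ] F) :
    IsSchatten p (T ∘L A) := by
  have hp0 := zero_le_one.trans hp
  have := ((hT.adjoint hp0).comp_left hp (ContinuousLinearMap.adjoint A)).adjoint hp0
  rwa [adjoint_comp, adjoint_adjoint, adjoint_adjoint] at this

/-- Even indices suffice: `s_{2n}(S T) ≤ s_n(S) s_n(T)`, and `a b ≤ a² + b²` for the `p`-th powers.
-/
theorem IsSchatten.comp_of_two_mul [CompleteSpace E] [CompleteSpace F] [CompleteSpace G] {p : ℝ}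
    (hp : 0 ≤ p) {S : F →L[ℂ] G} {T : E →L[ℂ] F} (hS : IsSchatten (2 * p) S)
    (hT : IsSchatten (2 * p) T) : IsSchatten p (S ∘L T) := by
  refine isSchatten_of_singularNumber_mul_le hp two_pos (Summable.add hS hT) fun n => ?_
  have hs := singularNumber_nonneg S n
  have ht := singularNumber_nonneg T n
  rw [two_mul n]
  refine (Real.rpow_le_rpow (singularNumber_nonneg _ _) (singularNumber_comp_le S T n n)
    hp).trans ?_
  have e : ∀ a : ℝ, 0 ≤ a → a ^ (2 * p) = (a ^ p) ^ 2 := fun a ha => by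
    rw [mul_comm, Real.rpow_mul ha, Real.rpow_two]
  rw [Real.mul_rpow hs ht, e _ hs, e _ ht]
  nlinarith [sq_nonneg (singularNumber S n ^ p - singularNumber T n ^ p),
    sq_nonneg (singularNumber S n ^ p + singularNumber T n ^ p)]

theorem IsSchatten.of_adjoint_comp_self [CompleteSpace E] [CompleteSpace F] {p : ℝ} (hp : 0 ≤ p)
    {T : E →L[ℂ] F} (hT : IsSchatten p (ContinuousLinearMap.adjoint T ∘L T)) :
    IsSchatten (2 * p) T := by
  refine Summable.of_nonneg_of_le (fun n => Real.rpow_nonneg (singularNumber_nonneg _ n) _)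
    (fun n => ?_) hT
  rw [Real.rpow_mul (singularNumber_nonneg _ n), Real.rpow_two]
  exact Real.rpow_le_rpow (sq_nonneg _) (singularNumber_sq_le T n) hp

/-- Singular numbers of size `O(1 / N)` at indices of size `O(N ^ D)` with `D < p` are
`p`-summable. -/
theorem isSchatten_of_polynomial_growth {T : E →L[ℂ] F} {p D C c : ℝ} (hD : 0 < D) (hDp : D < p)
    (hC : 0 < C) (hc : 0 ≤ c)
    (h : ∀ N m : ℕ, C * ((N : ℝ) + 1) ^ D ≤ m → singularNumber T m ≤ c / ((N : ℝ) + 1)) :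
    IsSchatten p T := by
  have hp : 0 < p := hD.trans hDp
  have hsum : Summable fun m : ℕ => (2 * c * C ^ (1 / D)) ^ p * (m : ℝ) ^ (-(p / D)) := by
    refine Summable.mul_left _ (Real.summable_nat_rpow.mpr ?_)
    rw [neg_lt_neg_iff, one_lt_div hD]
    exact hDp
  refine hsum.of_norm_bounded_eventually_nat ?_
  filter_upwards [Filter.eventually_ge_atTop (⌈C⌉₊ + 1)] with m hm
  have hCm : C ≤ m := (Nat.le_ceil C).trans (by exact_mod_cast (Nat.le_succ _).trans hm)
  have hm0 : (0 : ℝ) < m := hC.trans_le hCm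
  -- `x` solves `C x ^ D = m`, so `N = ⌊x⌋ - 1` is the best choice in `h`; `C ≤ m` makes `x ≥ 1`.
  set x : ℝ := ((m : ℝ) / C) ^ (1 / D) with hx
  have hmC : 1 ≤ (m : ℝ) / C := (one_le_div hC).mpr hCm
  have hx1 : 1 ≤ x := Real.one_le_rpow hmC (by positivity)
  have hx0 : 0 < x := one_pos.trans_le hx1
  have hM : 1 ≤ ⌊x⌋₊ := Nat.one_le_floor_iff _ |>.mpr hx1
  have hcast : ((⌊x⌋₊ - 1 : ℕ) : ℝ) + 1 = ⌊x⌋₊ := by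
    rw [Nat.cast_sub hM]
    simp
  have hMle : (⌊x⌋₊ : ℝ) ≤ x := Nat.floor_le hx0.le
  have hlt : x < ⌊x⌋₊ + 1 := Nat.lt_floor_add_one x
  have hM1 : (1 : ℝ) ≤ ⌊x⌋₊ := by exact_mod_cast hM
  have hs := h (⌊x⌋₊ - 1) m (by
    rw [hcast]
    calc C * (⌊x⌋₊ : ℝ) ^ D ≤ C * x ^ D := by gcongr
      _ = m := by
        rw [hx, ← Real.rpow_mul (by positivity), one_div_mul_cancel hD.ne', Real.rpow_one]
        field_simp)
  rw [hcast] at hs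
  -- Rounding costs a factor of at most two: `x < ⌊x⌋ + 1 ≤ 2 ⌊x⌋`.
  have hs2 : singularNumber T m ≤ 2 * c / x := by
    refine hs.trans ?_
    rw [div_le_div_iff₀ (by linarith) hx0]
    nlinarith
  rw [Real.norm_of_nonneg (Real.rpow_nonneg (singularNumber_nonneg _ _) _)]
  refine (Real.rpow_le_rpow (singularNumber_nonneg _ _) hs2 hp.le).trans (le_of_eq ?_)
  have : 2 * c / x = 2 * c * C ^ (1 / D) * (m : ℝ) ^ (-(1 / D)) := by
    rw [hx, Real.div_rpow hm0.le hC.le, Real.rpow_neg hm0.le]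
    field_simp
  rw [this, Real.mul_rpow (by positivity) (by positivity), ← Real.rpow_mul hm0.le]
  congr 2
  ring

end Schatten

/-! ### Compressions to co-invariant subspaces -/

section Compression

open ContinuousLinearMap

variable {H : Type*} [NormedAddCommGroup H] [InnerProductSpace ℂ H]

/-- The compression of `S` to the subspace `U`. -/
noncomputable abbrev compression (U : Submodule ℂ H) [CompleteSpace U] (S : H →L[ℂ] H) :
    U →L[ℂ] U :=
  U.orthogonalProjectionOnto ∘L S ∘L U.subtypeL

/-- The part of `S` that maps `U` to its orthogonal complement. -/
noncomputable def offDiagonal (U : Submodule ℂ H) [CompleteSpace U] (S : H →L[ℂ] H) :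
    U →L[ℂ] H :=
  S ∘L U.subtypeL - U.subtypeL ∘L compression U S

variable {U V : Submodule ℂ H} [CompleteSpace U] [CompleteSpace V]

theorem offDiagonal_apply (S : H →L[ℂ] H) (x : U) :
    offDiagonal U S x = S x - U.starProjection (S x) := rfl

/-- Compressing to a smaller subspace preserves Schatten classes. -/
theorem isSchatten_compression_of_le {p : ℝ} (hp : 1 ≤ p) (hUV : U ≤ V) {K : H →L[ℂ] H}
    (hK : IsSchatten p (compression V K)) : IsSchatten p (compression U K) := by
  have : compression U K = (U.orthogonalProjectionOnto ∘L V.subtypeL) ∘L compression V K ∘L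
      (V.orthogonalProjectionOnto ∘L U.subtypeL) := by
    ext x
    change U.starProjection (K x) =
      U.starProjection (V.starProjection (K (V.starProjection x)))
    rw [Submodule.starProjection_eq_self_iff.mpr (hUV x.2)]
    exact (DFunLike.congr_fun (Submodule.starProjection_comp_starProjection_of_le hUV) _).symm
  rw [this]
  exact (hK.comp_right hp _).comp_left hp _

variable [CompleteSpace H]

theorem adjoint_offDiagonal_apply (S : H →L[ℂ] H) (y : H) :
    (adjoint (offDiagonal U S) y : H) = U.starProjection (adjoint S (y - U.starProjection y)) := by
  have : adjoint (offDiagonal U S) y =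
      U.orthogonalProjectionOnto (adjoint S (y - U.starProjection y)) := by
    refine ext_inner_left ℂ fun x => ?_
    rw [adjoint_inner_right, offDiagonal_apply, inner_sub_left,
      Submodule.inner_starProjection_left_eq_right, ← inner_sub_right, ← adjoint_inner_right,
      Submodule.inner_orthogonalProjectionOnto_eq_of_mem_left]
  rw [this]
  rfl

theorem adjoint_compression (S : H →L[ℂ] H) :
    adjoint (compression U S) = compression U (adjoint S) := by
  rw [compression, adjoint_comp, adjoint_comp, Submodule.adjoint_orthogonalProjectionOnto,
    Submodule.adjoint_subtypeL]
  rfl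

/-- Invariance under `T^*` removes the middle projection from `P S P T^* P`. In `P T^* P S P` it has
to be kept, and replacing it by the identity costs `P T^* (1 - P) S P`, the product of off-diagonal
parts. -/
theorem commutator_compression_eq (S T : H →L[ℂ] H) (hT : ∀ x ∈ U, adjoint T x ∈ U) :
    compression U S ∘L adjoint (compression U T) - adjoint (compression U T) ∘L compression U S =
      compression U (S ∘L adjoint T - adjoint T ∘L S) +
        adjoint (offDiagonal U T) ∘L offDiagonal U S := by
  ext x
  have hTx : U.starProjection (adjoint T (x : H)) = adjoint T (x : H) :=
    Submodule.starProjection_eq_self_iff.mpr (hT _ x.2)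
  have hTy : U.starProjection (adjoint T (U.starProjection (S x))) =
      adjoint T (U.starProjection (S x)) :=
    Submodule.starProjection_eq_self_iff.mpr (hT _ (Submodule.starProjection_apply_mem _ _))
  have hid : U.starProjection (U.starProjection (S x)) = U.starProjection (S x) :=
    Submodule.starProjection_eq_self_iff.mpr (Submodule.starProjection_apply_mem _ _)
  rw [adjoint_compression]
  change U.starProjection (S (U.starProjection (adjoint T x))) -
    U.starProjection (adjoint T (U.starProjection (S x))) =
    U.starProjection (S (adjoint T x) - adjoint T (S x)) +
      (adjoint (offDiagonal U T) (offDiagonal U S x) : H)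
  rw [adjoint_offDiagonal_apply, offDiagonal_apply, hTx, hTy]
  simp only [map_sub, hid, hTy]
  abel

/-- If an algebraic sum of subspaces is closed, then the norm on the sum is controlled by the
projections to the summands. -/
theorem exists_norm_le_sum_starProjection {ι : Type*} [Fintype ι] (U : ι → Submodule ℂ H)
    [∀ j, CompleteSpace (U j)] (h : IsClosed ((⨆ j, U j : Submodule ℂ H) : Set H)) :
    ∃ C : ℝ, 0 ≤ C ∧ ∀ y ∈ ⨆ j, U j, ‖y‖ ≤ C * ∑ j, ‖(U j).starProjection y‖ := by
  classical
  set W := ⨆ j, U j with hW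
  have : CompleteSpace W := h.completeSpace_coe
  let f : (∀ j, U j) →L[ℂ] H := ∑ j, (U j).subtypeL ∘L ContinuousLinearMap.proj j
  have hf : ∀ x, f x = ∑ j, (x j : H) := fun x => by simp [f]
  have hfW : ∀ x, f x ∈ W := fun x => by
    rw [hf]
    exact W.sum_mem fun j _ => Submodule.mem_iSup_of_mem j (x j).2
  let g : (∀ j, U j) →L[ℂ] W := f.codRestrict W hfW
  have hg : Function.Surjective g := fun y => by
    obtain ⟨x, hxU, hxy⟩ := (Submodule.mem_iSup_iff_exists_finsupp U y).mp y.2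
    refine ⟨fun j => ⟨x j, hxU j⟩, Subtype.ext ?_⟩
    change f _ = y
    rw [hf, ← hxy, Finsupp.sum_fintype _ _ fun _ => rfl]
  -- Open mapping theorem: the closed sum is complete, so decompositions can be chosen with norm
  -- control.
  obtain ⟨C, hC, hpre⟩ := g.exists_preimage_norm_le hg
  refine ⟨C, hC.le, fun y hy => ?_⟩
  obtain ⟨x, hx, hxn⟩ := hpre ⟨y, hy⟩
  have hxy : ∑ j, (x j : H) = y := by
    rw [← hf]
    exact congrArg Subtype.val hx
  have hxn : ‖x‖ ≤ C * ‖y‖ := hxn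
  -- Pairing `y` with its own decomposition brings in the projections, since `⟨x_j, y⟩ = ⟨x_j, P_j
  -- y⟩`.
  have key : ‖y‖ * ‖y‖ ≤ (C * ∑ j, ‖(U j).starProjection y‖) * ‖y‖ := by
    calc ‖y‖ * ‖y‖ = RCLike.re (inner ℂ y y) := by rw [inner_self_eq_norm_mul_norm]
      _ = ∑ j, RCLike.re (inner ℂ (x j : H) y) := by
        rw [← map_sum, ← sum_inner, hxy]
      _ ≤ ∑ j, (C * ‖y‖) * ‖(U j).starProjection y‖ := by
        refine Finset.sum_le_sum fun j _ => ?_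
        have : inner ℂ (x j : H) y = inner ℂ (x j : H) ((U j).starProjection y) := by
          rw [← Submodule.inner_starProjection_left_eq_right,
            Submodule.starProjection_eq_self_iff.mpr (x j).2]
        rw [this]
        refine (re_inner_le_norm _ _).trans (mul_le_mul_of_nonneg_right ?_ (norm_nonneg _))
        exact (norm_le_pi_norm x j).trans hxn
      _ = _ := by rw [← Finset.mul_sum]; ring
  rcases (norm_nonneg y).eq_or_lt with h0 | h0
  · rw [← h0]
    positivity
  · exact le_of_mul_le_mul_right key h0

/-- Off-diagonal parts of an intersection of subspaces whose complements have closed sum. -/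
theorem isSchatten_offDiagonal_of_isClosed_iSup_orthogonal {ι : Type*} [Fintype ι] {p : ℝ}
    (hp : 1 ≤ p) {V : Submodule ℂ H} [CompleteSpace V] (U : ι → Submodule ℂ H)
    [∀ j, CompleteSpace (U j)] (hV : V = ⨅ j, U j)
    (h : IsClosed ((⨆ j, (U j)ᗮ : Submodule ℂ H) : Set H)) (S : H →L[ℂ] H)
    (hS : ∀ j, IsSchatten p (offDiagonal (U j) S)) : IsSchatten p (offDiagonal V S) := by
  obtain ⟨C, hC, hle⟩ := exists_norm_le_sum_starProjection (fun j => (U j)ᗮ) h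
  have hVU : ∀ j, V ≤ U j := fun j => hV ▸ iInf_le U j
  have hmem : ∀ y ∈ Vᗮ, y ∈ ⨆ j, (U j)ᗮ := fun y hy => by
    have e : (⨆ j, (U j)ᗮ)ᗮ = V := by
      rw [← Submodule.iInf_orthogonal, hV]
      exact iInf_congr fun j => Submodule.orthogonal_orthogonal _
    rw [← e] at hy
    rwa [Submodule.orthogonal_orthogonal_eq_closure, h.submodule_topologicalClosure_eq] at hy
  refine IsSchatten.of_norm_le_sum hp _
    (fun j => offDiagonal (U j) S ∘L (U j).orthogonalProjectionOnto ∘L V.subtypeL) hC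
    (fun x => ?_) fun j => (hS j).comp_right hp _
  refine (hle _ (hmem _ ?_)).trans_eq ?_
  · rw [offDiagonal_apply]
    exact Submodule.sub_starProjection_mem_orthogonal _
  congr 1
  refine Finset.sum_congr rfl fun j _ => ?_
  congr 1
  have hx : ((U j).starProjection (x : H)) = x :=
    Submodule.starProjection_eq_self_iff.mpr (hVU j x.2)
  have hSx : (U j).starProjection (V.starProjection (S x)) = V.starProjection (S x) :=
    Submodule.starProjection_eq_self_iff.mpr (hVU j (Submodule.starProjection_apply_mem _ _))
  -- `V ≤ U j`, so projecting to `(U j)ᗮ` removes the `V`-component of `S x` and leaves the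
  -- off-diagonal part for `U j`.
  change (U j)ᗮ.starProjection (offDiagonal V S x) =
    S ((U j).starProjection x) - (U j).starProjection (S ((U j).starProjection x))
  rw [hx, Submodule.starProjection_orthogonal_val, offDiagonal_apply, map_sub, hSx]
  abel

/-- Off-diagonal parts of a closed sum of subspaces. -/
theorem isSchatten_offDiagonal_of_isClosed_iSup {ι : Type*} [Fintype ι] {p : ℝ}
    (hp : 1 ≤ p) {V : Submodule ℂ H} [CompleteSpace V] (U : ι → Submodule ℂ H)
    [∀ j, CompleteSpace (U j)] (hV : V = ⨆ j, U j)
    (h : IsClosed ((⨆ j, U j : Submodule ℂ H) : Set H)) (S : H →L[ℂ] H)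
    (hS : ∀ j, IsSchatten p (offDiagonal (U j) S)) : IsSchatten p (offDiagonal V S) := by
  obtain ⟨C, hC, hle⟩ := exists_norm_le_sum_starProjection U h
  have hUV : ∀ j, U j ≤ V := fun j => hV ▸ le_iSup U j
  have hp0 : 0 ≤ p := zero_le_one.trans hp
  -- The off-diagonal part takes values in `Vᗮ`, where the norm estimate says nothing; its adjoint
  -- takes values in `V`, the closed sum.
  rw [← adjoint_adjoint (offDiagonal V S)]
  refine IsSchatten.adjoint hp0 (IsSchatten.of_norm_le_sum hp _
    (fun j => adjoint (offDiagonal (U j) S) ∘L Vᗮ.starProjection) hC (fun y => ?_)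
    fun j => ((hS j).adjoint hp0).comp_right hp _)
  have hmem : (adjoint (offDiagonal V S) y : H) ∈ ⨆ j, U j := hV ▸ Subtype.mem _
  refine (hle _ hmem).trans_eq ?_
  congr 1
  refine Finset.sum_congr rfl fun j _ => ?_
  change _ = ‖(adjoint (offDiagonal (U j) S) (Vᗮ.starProjection y) : H)‖
  rw [adjoint_offDiagonal_apply, adjoint_offDiagonal_apply, Submodule.starProjection_orthogonal_val]
  have h0 : (U j).starProjection (y - V.starProjection y) = 0 :=
    (U j).starProjection_apply_eq_zero_iff.mpr
      (Submodule.orthogonal_le (hUV j) (Submodule.sub_starProjection_mem_orthogonal y))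
  rw [h0, sub_zero]
  congr 1
  exact DFunLike.congr_fun (Submodule.starProjection_comp_starProjection_of_le (hUV j)) _

end Compression

/-! ### Diagonal operators on the Drury-Arveson space -/

section Diagonal

open MvPolynomial ContinuousLinearMap

variable {d : ℕ}

theorem inner_incl (f g : MvPolynomial (Fin d) ℂ) :
    inner ℂ (incl d f) (incl d g) = polyInner f g :=
  UniformSpace.Completion.inner_coe (𝕜 := ℂ) (toPoly d f) (toPoly d g)

theorem norm_incl (f : MvPolynomial (Fin d) ℂ) : ‖incl d f‖ = ‖toPoly d f‖ :=
  UniformSpace.Completion.norm_coe (toPoly d f)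

theorem incl_injective : Function.Injective (incl d) := fun _ _ h =>
  (toPoly d).injective (UniformSpace.Completion.coe_injective (Poly d) h)

theorem induction_on_incl {P : Space d → Prop} (x : Space d) (hP : IsClosed {x | P x})
    (h : ∀ f, P (incl d f)) : P x :=
  UniformSpace.Completion.induction_on x hP fun f => h ((toPoly d).symm f)

theorem ext_monomial {X : Type*} [NormedAddCommGroup X] [NormedSpace ℂ X]
    {A B : Space d →L[ℂ] X}
    (h : ∀ α, A (incl d (monomial α 1)) = B (incl d (monomial α 1))) : A = B := by
  have hlin : A.toLinearMap ∘ₗ incl d = B.toLinearMap ∘ₗ incl d := by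
    refine (basisMonomials (Fin d) ℂ).ext fun α => ?_
    rw [coe_basisMonomials]
    exact h α
  ext x
  refine induction_on_incl x (isClosed_eq A.continuous B.continuous) fun f => ?_
  exact LinearMap.congr_fun hlin f

theorem ext_inner_monomial {x y : Space d}
    (h : ∀ α, inner ℂ x (incl d (monomial α 1)) = inner ℂ y (incl d (monomial α 1))) : x = y := by
  have : innerSL ℂ x = innerSL ℂ y := ext_monomial h
  exact innerSL_inj.mp this

/-- Multiplication of the coefficients by the scalars `c α`. -/
noncomputable def coeffMul (c : (Fin d →₀ ℕ) → ℝ) :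
    MvPolynomial (Fin d) ℂ →ₗ[ℂ] MvPolynomial (Fin d) ℂ :=
  (basisMonomials (Fin d) ℂ).constr ℂ fun α => monomial α (c α : ℂ)

theorem coeffMul_monomial (c : (Fin d →₀ ℕ) → ℝ) (α : Fin d →₀ ℕ) (r : ℂ) :
    coeffMul c (monomial α r) = monomial α (c α * r) := by
  have h : coeffMul c (monomial α 1) = monomial α (c α : ℂ) := by
    have := (basisMonomials (Fin d) ℂ).constr_basis ℂ (fun α => monomial α (c α : ℂ)) α
    rwa [coe_basisMonomials] at this
  have e : monomial α r = r • monomial α (1 : ℂ) := by rw [smul_monomial, smul_eq_mul, mul_one]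
  rw [e, map_smul, h, smul_monomial, smul_eq_mul, mul_comm]

theorem coeff_coeffMul (c : (Fin d →₀ ℕ) → ℝ) (f : MvPolynomial (Fin d) ℂ) (α : Fin d →₀ ℕ) :
    (coeffMul c f).coeff α = c α * f.coeff α := by
  classical
  induction f using MvPolynomial.induction_on' with
  | monomial β r =>
    rw [coeffMul_monomial, coeff_monomial, coeff_monomial]
    split_ifs with h
    · rw [h]
    · rw [mul_zero]
  | add f g hf hg => rw [map_add, coeff_add, coeff_add, hf, hg, mul_add]

theorem norm_toPoly_coeffMul_le {c : (Fin d →₀ ℕ) → ℝ} {C : ℝ} (hc : ∀ α, |c α| ≤ C) (hC : 0 ≤ C)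
    (f : MvPolynomial (Fin d) ℂ) : ‖toPoly d (coeffMul c f)‖ ≤ C * ‖toPoly d f‖ := by
  refine le_of_sq_le_sq ?_ (mul_nonneg hC (norm_nonneg _))
  have hsupp : (coeffMul c f).support ⊆ f.support := fun α hα => by
    rw [mem_support_iff, coeff_coeffMul] at hα
    exact mem_support_iff.mpr (right_ne_zero_of_mul hα)
  have h : ‖toPoly d (coeffMul c f)‖ ^ 2 =
      ∑ α ∈ f.support, ‖(coeffMul c f).coeff α‖ ^ 2 * weight α := by
    rw [norm_sq_eq]
    refine Finset.sum_subset hsupp fun α _ hα => ?_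
    rw [notMem_support_iff.mp hα]
    simp
  rw [h, mul_pow, norm_sq_eq, Finset.mul_sum]
  refine Finset.sum_le_sum fun α _ => ?_
  rw [coeff_coeffMul, norm_mul, Complex.norm_real, mul_pow, Real.norm_eq_abs, mul_assoc]
  refine mul_le_mul_of_nonneg_right (pow_le_pow_left₀ (abs_nonneg _) (hc α) 2) ?_
  exact mul_nonneg (sq_nonneg _) (weight_pos α).le

/-- The diagonal operator on `H²_d` with eigenvalue `c α` at `z ^ α` for bounded `c`. -/
noncomputable def diagonal (c : (Fin d →₀ ℕ) → ℝ) {C : ℝ} (hc : ∀ α, |c α| ≤ C) :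
    Space d →L[ℂ] Space d :=
  ContinuousLinearMap.extend
    ((UniformSpace.Completion.toComplL (𝕜 := ℂ) (E := Poly d)).comp
      (((toPoly d).toLinearMap ∘ₗ coeffMul c ∘ₗ (toPoly d).symm.toLinearMap).mkContinuous C
        fun f => norm_toPoly_coeffMul_le hc ((abs_nonneg _).trans (hc 0)) ((toPoly d).symm f)))
    (UniformSpace.Completion.toComplL (𝕜 := ℂ) (E := Poly d))

variable {c : (Fin d →₀ ℕ) → ℝ} {C : ℝ} (hc : ∀ α, |c α| ≤ C)

theorem diagonal_incl (f : MvPolynomial (Fin d) ℂ) :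
    diagonal c hc (incl d f) = incl d (coeffMul c f) :=
  ContinuousLinearMap.extend_eq _
    UniformSpace.Completion.denseRange_coe
    (UniformSpace.Completion.isUniformInducing_coe (Poly d)) (toPoly d f)

theorem diagonal_monomial (α : Fin d →₀ ℕ) :
    diagonal c hc (incl d (monomial α 1)) = (c α : ℂ) • incl d (monomial α 1) := by
  rw [diagonal_incl, coeffMul_monomial, ← map_smul, smul_monomial, smul_eq_mul]

theorem norm_diagonal_apply_le (x : Space d) : ‖diagonal c hc x‖ ≤ C * ‖x‖ := by
  refine induction_on_incl (P := fun x => ‖diagonal c hc x‖ ≤ C * ‖x‖) x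
    (isClosed_le (by fun_prop) (by fun_prop)) fun f => ?_
  rw [diagonal_incl, norm_incl, norm_incl]
  exact norm_toPoly_coeffMul_le hc ((abs_nonneg _).trans (hc 0)) f

theorem inner_monomial_monomial (α β : Fin d →₀ ℕ) :
    inner ℂ (incl d (monomial α 1)) (incl d (monomial β 1)) =
      if α = β then (weight α : ℂ) else 0 := by
  rw [inner_incl, polyInner_monomial]

theorem adjoint_diagonal : adjoint (diagonal c hc) = diagonal c hc := by
  refine ext_monomial fun α => ext_inner_monomial fun β => ?_
  rw [adjoint_inner_left, diagonal_monomial, diagonal_monomial, inner_smul_left, inner_smul_right,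
    inner_monomial_monomial, Complex.conj_ofReal]
  split_ifs with h
  · rw [h]
  · simp

theorem inner_diagonal_left (x y : Space d) :
    inner ℂ (diagonal c hc x) y = inner ℂ x (diagonal c hc y) := by
  rw [← adjoint_inner_left, adjoint_diagonal]

/-! ### Commutators of the shifts -/

theorem shift_monomial (i : Fin d) (α : Fin d →₀ ℕ) :
    shift i (incl d (monomial α 1)) = incl d (monomial (Finsupp.single i 1 + α) 1) := by
  rw [shift_incl, X, monomial_mul, one_mul]

theorem weight_single_add (i : Fin d) (α : Fin d →₀ ℕ) :
    weight (Finsupp.single i 1 + α) = (α i + 1) / ((α.degree : ℝ) + 1) * weight α := by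
  have hprod : ∏ j, ((Finsupp.single i 1 + α : Fin d →₀ ℕ) j)! = (α i + 1) * ∏ j, (α j)! := by
    rw [← Finset.mul_prod_erase _ _ (Finset.mem_univ i),
      ← Finset.mul_prod_erase _ (fun j => (α j)!) (Finset.mem_univ i)]
    have h : ∏ j ∈ Finset.univ.erase i, ((Finsupp.single i 1 + α : Fin d →₀ ℕ) j)! =
        ∏ j ∈ Finset.univ.erase i, (α j)! := by
      refine Finset.prod_congr rfl fun j hj => ?_
      rw [Finsupp.add_apply, Finsupp.single_eq_of_ne (Finset.ne_of_mem_erase hj), zero_add]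
    rw [h, Finsupp.add_apply, Finsupp.single_eq_same, add_comm 1, Nat.factorial_succ, mul_assoc]
  have hsum : ∑ j, (Finsupp.single i 1 + α : Fin d →₀ ℕ) j = ∑ j, α j + 1 := by
    simp [Finset.sum_add_distrib, Finsupp.single_apply, add_comm]
  unfold weight
  rw [hprod, hsum, Nat.factorial_succ, Finsupp.degree_eq_sum]
  push_cast
  rw [mul_div_mul_comm]

theorem adjoint_shift_monomial_add (j : Fin d) (α : Fin d →₀ ℕ) :
    adjoint (shift j) (incl d (monomial (Finsupp.single j 1 + α) 1)) =
      (((α j + 1) / ((α.degree : ℝ) + 1) : ℝ) : ℂ) • incl d (monomial α 1) := by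
  refine ext_inner_monomial fun β => ?_
  rw [adjoint_inner_left, shift_monomial, inner_smul_left, inner_monomial_monomial,
    inner_monomial_monomial, weight_single_add, Complex.conj_ofReal]
  by_cases h : α = β
  · simp [h]
  · simp [h]

theorem adjoint_shift_monomial_of_eq_zero {j : Fin d} {α : Fin d →₀ ℕ} (h : α j = 0) :
    adjoint (shift j) (incl d (monomial α 1)) = 0 := by
  refine ext_inner_monomial fun β => ?_
  rw [adjoint_inner_left, shift_monomial, inner_zero_left, inner_monomial_monomial, if_neg]
  rintro rfl
  simp at h

theorem norm_shift_apply_le (i : Fin d) (x : Space d) : ‖shift i x‖ ≤ ‖x‖ := by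
  refine induction_on_incl (P := fun x => ‖shift i x‖ ≤ ‖x‖) x
    (isClosed_le (by fun_prop) (by fun_prop)) fun f => ?_
  rw [shift_incl, norm_incl, norm_incl]
  exact (norm_mulX_le i (toPoly d f)).trans_eq (one_mul _)

theorem norm_shift_le (i : Fin d) : ‖shift i‖ ≤ 1 :=
  opNorm_le_bound _ zero_le_one fun x => (norm_shift_apply_le i x).trans_eq (one_mul _).symm

/-- The commutator `[S_i, S_j^*]`. -/
noncomputable def shiftCommutator (i j : Fin d) : Space d →L[ℂ] Space d :=
  shift i ∘L adjoint (shift j) - adjoint (shift j) ∘L shift i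

/-- Both orders yield multiples of one monomial, with factors `α_j / |α|` and `(α_j + δ_ij) / (|α| +
1)`. Their difference contains `1 / (|α| + 1)`, which can be split off as a diagonal operator. -/
theorem shiftCommutator_monomial (i j : Fin d) (α : Fin d →₀ ℕ) :
    shiftCommutator i j (incl d (monomial α 1)) =
      (((α.degree : ℝ) + 1)⁻¹ : ℂ) • (shift i (adjoint (shift j) (incl d (monomial α 1))) -
        if i = j then incl d (monomial α 1) else 0) := by
  have hdeg : ∀ (i : Fin d) (β : Fin d →₀ ℕ), (Finsupp.single i 1 + β).degree = β.degree + 1 :=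
    fun i β => by rw [map_add, Finsupp.degree_single, add_comm]
  change shift i (adjoint (shift j) _) - adjoint (shift j) (shift i _) = _
  rw [shift_monomial]
  -- Here `S_j^*` kills `z ^ α`; this case also contains `α = 0`, where `α_j / |α|` has no meaning.
  by_cases hα : α j = 0
  · rw [adjoint_shift_monomial_of_eq_zero hα, map_zero]
    by_cases hij : i = j
    · subst hij
      rw [adjoint_shift_monomial_add, hα, if_pos rfl]
      simp
    · rw [adjoint_shift_monomial_of_eq_zero, if_neg hij]
      · simp
      · rw [Finsupp.add_apply, hα, Finsupp.single_eq_of_ne (Ne.symm hij)]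
  · obtain ⟨β, rfl⟩ : ∃ β, α = Finsupp.single j 1 + β := by
      refine ⟨α - Finsupp.single j 1, (add_tsub_cancel_of_le ?_).symm⟩
      exact Finsupp.single_le_iff.mpr (Nat.one_le_iff_ne_zero.mpr hα)
    have hcomm : Finsupp.single i 1 + (Finsupp.single j 1 + β) =
        Finsupp.single j 1 + (Finsupp.single i 1 + β) := add_left_comm _ _ _
    rw [hcomm, adjoint_shift_monomial_add, adjoint_shift_monomial_add, map_smul, shift_monomial,
      hdeg, hdeg]
    have h1 : (β.degree : ℂ) + 1 ≠ 0 := Nat.cast_add_one_ne_zero _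
    have h2 : (β.degree : ℂ) + 1 + 1 ≠ 0 := by
      exact_mod_cast Nat.cast_add_one_ne_zero (R := ℂ) (β.degree + 1)
    by_cases hij : i = j
    · subst hij
      rw [if_pos rfl, ← sub_smul]
      have hv : ∀ (e : ℂ) (v : Space d), e • v - v = (e - 1) • v := fun e v => by
        rw [sub_smul, one_smul]
      rw [hv, smul_smul, Finsupp.add_apply, Finsupp.single_eq_same]
      congr 1
      push_cast
      field_simp
      ring
    · rw [if_neg hij, sub_zero, ← sub_smul, smul_smul, Finsupp.add_apply,
        Finsupp.single_eq_of_ne (Ne.symm hij)]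
      congr 1
      push_cast
      field_simp
      ring

/-- The indicator function of the degrees at least `N`. -/
noncomputable def tailCoeff (d N : ℕ) (α : Fin d →₀ ℕ) : ℝ := if N ≤ α.degree then 1 else 0

/-- The indicator function of the degree `n`. -/
noncomputable def degreeCoeff (d n : ℕ) (α : Fin d →₀ ℕ) : ℝ := if α.degree = n then 1 else 0

theorem abs_tailCoeff_le (N : ℕ) (α : Fin d →₀ ℕ) : |tailCoeff d N α| ≤ 1 := by
  unfold tailCoeff
  split_ifs <;> simp

theorem abs_degreeCoeff_le (n : ℕ) (α : Fin d →₀ ℕ) : |degreeCoeff d n α| ≤ 1 := by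
  unfold degreeCoeff
  split_ifs <;> simp

/-- The projection to the closed span of the monomials of degree at least `N`. -/
noncomputable abbrev tailProj (d N : ℕ) : Space d →L[ℂ] Space d :=
  diagonal (tailCoeff d N) (abs_tailCoeff_le N)

/-- The projection to the homogeneous polynomials of degree `n`. -/
noncomputable abbrev degreeProj (d n : ℕ) : Space d →L[ℂ] Space d :=
  diagonal (degreeCoeff d n) (abs_degreeCoeff_le n)

theorem sum_degreeProj_add_tailProj (N : ℕ) :
    ∑ n ∈ Finset.range N, degreeProj d n + tailProj d N = ContinuousLinearMap.id ℂ (Space d) := by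
  refine ext_monomial fun α => ?_
  rw [add_apply, sum_apply, diagonal_monomial]
  simp only [diagonal_monomial, degreeCoeff, tailCoeff]
  rw [← Finset.sum_smul, ← add_smul]
  have : (∑ n ∈ Finset.range N, (((if α.degree = n then 1 else 0 : ℝ)) : ℂ)) +
      ((if N ≤ α.degree then 1 else 0 : ℝ) : ℂ) = 1 := by
    simp only [apply_ite Complex.ofReal, Complex.ofReal_one, Complex.ofReal_zero,
      Finset.sum_ite_eq, Finset.mem_range]
    rcases lt_or_ge α.degree N with h | h
    · rw [if_pos h, if_neg (not_le.mpr h), add_zero]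
    · rw [if_neg (not_lt.mpr h), if_pos h, zero_add]
  rw [this, one_smul]
  rfl

/-- On the tail the diagonal factor is at most `1 / (N + 1)`; the other factor `S_i S_j^* - δ_ij`
has norm at most `2`. -/
theorem norm_shiftCommutator_tailProj_le (i j : Fin d) (N : ℕ) (x : Space d) :
    ‖shiftCommutator i j (tailProj d N x)‖ ≤ 2 / ((N : ℝ) + 1) * ‖x‖ := by
  have hN : (0 : ℝ) < (N : ℝ) + 1 := by positivity
  have hb : ∀ α : Fin d →₀ ℕ, |tailCoeff d N α * ((α.degree : ℝ) + 1)⁻¹| ≤ 1 / ((N : ℝ) + 1) := by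
    intro α
    unfold tailCoeff
    split_ifs with h
    · rw [one_mul, abs_of_nonneg (by positivity), ← one_div]
      have : (N : ℝ) ≤ α.degree := by exact_mod_cast h
      gcongr
    · rw [zero_mul, abs_zero]
      positivity
  have key : shiftCommutator i j ∘L tailProj d N =
      (shift i ∘L adjoint (shift j) - if i = j then ContinuousLinearMap.id ℂ (Space d) else 0) ∘L
        diagonal _ hb := by
    refine ext_monomial fun α => ?_
    rw [comp_apply, comp_apply, diagonal_monomial, diagonal_monomial, map_smul, map_smul,
      shiftCommutator_monomial, smul_smul]
    push_cast
    congr 1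
    split_ifs <;> rfl
  have hx : shiftCommutator i j (tailProj d N x) = (shiftCommutator i j ∘L tailProj d N) x := rfl
  rw [hx, key]
  set y := diagonal _ hb x with hy
  have hyn : ‖y‖ ≤ 1 / ((N : ℝ) + 1) * ‖x‖ := norm_diagonal_apply_le hb x
  have h1 : ‖shift i (adjoint (shift j) y)‖ ≤ ‖y‖ := by
    refine (norm_shift_apply_le i _).trans ((le_opNorm _ y).trans ?_)
    rw [LinearIsometryEquiv.norm_map]
    exact mul_le_of_le_one_left (norm_nonneg _) (norm_shift_le j)
  have h2 : ‖(if i = j then ContinuousLinearMap.id ℂ (Space d) else 0) y‖ ≤ ‖y‖ := by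
    split_ifs <;> simp
  calc ‖shift i (adjoint (shift j) y) - (if i = j then ContinuousLinearMap.id ℂ (Space d) else 0) y‖
      ≤ ‖y‖ + ‖y‖ := (norm_sub_le _ _).trans (add_le_add h1 h2)
    _ ≤ 1 / ((N : ℝ) + 1) * ‖x‖ + 1 / ((N : ℝ) + 1) * ‖x‖ := add_le_add hyn hyn
    _ = 2 / ((N : ℝ) + 1) * ‖x‖ := by ring

end Diagonal

/-! ### Homogeneous ideals -/

section Ideals

open MvPolynomial ContinuousLinearMap

attribute [local instance] MvPolynomial.gradedAlgebra

variable {d : ℕ} {I : Ideal (MvPolynomial (Fin d) ℂ)}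

theorem coeffMul_degreeCoeff (n : ℕ) (f : MvPolynomial (Fin d) ℂ) :
    coeffMul (degreeCoeff d n) f = homogeneousComponent n f := by
  ext α
  rw [coeff_coeffMul, coeff_homogeneousComponent, degreeCoeff]
  split_ifs <;> simp

theorem degreeProj_incl (n : ℕ) (f : MvPolynomial (Fin d) ℂ) :
    degreeProj d n (incl d f) = incl d (homogeneousComponent n f) := by
  rw [diagonal_incl, coeffMul_degreeCoeff]

theorem tailProj_incl_of_totalDegree_lt {N : ℕ} {f : MvPolynomial (Fin d) ℂ}
    (h : f.totalDegree < N) : tailProj d N (incl d f) = 0 := by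
  have : coeffMul (tailCoeff d N) f = 0 := by
    ext α
    rw [coeff_coeffMul, tailCoeff, coeff_zero]
    split_ifs with hα
    · rw [coeff_eq_zero_of_totalDegree_lt, mul_zero]
      exact h.trans_le hα
    · simp
  rw [diagonal_incl, this, map_zero]

theorem IsHomogeneousIdeal.homogeneousComponent_mem (hI : IsHomogeneousIdeal I) (n : ℕ)
    {f : MvPolynomial (Fin d) ℂ} (hf : f ∈ I) : homogeneousComponent n f ∈ I := by
  have h := hI n hf
  rwa [show ((DirectSum.decompose (homogeneousSubmodule (Fin d) ℂ) f n :
    homogeneousSubmodule (Fin d) ℂ n) : MvPolynomial (Fin d) ℂ) = homogeneousComponent n f from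
    decomposition.decompose'_apply f n] at h

theorem mem_quotientModule_iff {x : Space d} :
    x ∈ quotientModule I ↔ ∀ f ∈ I, inner ℂ (incl d f) x = 0 := by
  rw [Submodule.mem_orthogonal]
  exact ⟨fun h f hf => h _ (Submodule.mem_map_of_mem hf), fun h u ⟨f, hf, hu⟩ => hu ▸ h f hf⟩

theorem quotientModule_antitone :
    Antitone (quotientModule : Ideal (MvPolynomial (Fin d) ℂ) → Submodule ℂ (Space d)) :=
  fun _ _ h _ hx => mem_quotientModule_iff.mpr fun f hf => mem_quotientModule_iff.mp hx f (h hf)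

theorem quotientModule_iSup {ι : Type*} (I : ι → Ideal (MvPolynomial (Fin d) ℂ)) :
    quotientModule (⨆ j, I j) = ⨅ j, quotientModule (I j) := by
  refine le_antisymm (le_iInf fun j => quotientModule_antitone (le_iSup I j)) fun x hx => ?_
  rw [Submodule.mem_iInf] at hx
  refine mem_quotientModule_iff.mpr fun f hf => ?_
  refine Submodule.iSup_induction I (motive := fun f => inner ℂ (incl d f) x = 0) hf
    (fun j f hf => mem_quotientModule_iff.mp (hx j) f hf) ?_ fun f g hf hg => ?_
  · rw [map_zero, inner_zero_left]
  · rw [map_add, inner_add_left, hf, hg, add_zero]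

/-- This is dual to the invariance of the ideal under multiplication by `z_j`. -/
theorem adjoint_shift_mem_quotientModule (j : Fin d) {x : Space d} (hx : x ∈ quotientModule I) :
    adjoint (shift j) x ∈ quotientModule I := by
  refine mem_quotientModule_iff.mpr fun f hf => ?_
  rw [adjoint_inner_right, shift_incl]
  exact mem_quotientModule_iff.mp hx _ (I.mul_mem_left _ hf)

theorem degreeProj_mem_quotientModule (hI : IsHomogeneousIdeal I) (n : ℕ) {x : Space d}
    (hx : x ∈ quotientModule I) : degreeProj d n x ∈ quotientModule I := by
  refine mem_quotientModule_iff.mpr fun f hf => ?_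
  rw [← inner_diagonal_left, degreeProj_incl]
  exact mem_quotientModule_iff.mp hx _ (hI.homogeneousComponent_mem n hf)

instance finiteDimensional_homogeneousSubmodule (n : ℕ) :
    FiniteDimensional ℂ (homogeneousSubmodule (Fin d) ℂ n) :=
  Module.Finite.iff_fg.mpr (homogeneousSubmodule_fg _ _ n)

theorem isClosed_map_incl (U : Submodule ℂ (MvPolynomial (Fin d) ℂ)) [FiniteDimensional ℂ U] :
    IsClosed (U.map (incl d) : Set (Space d)) :=
  Submodule.closed_of_finiteDimensional _

theorem degreeProj_mem_map (n : ℕ) (x : Space d) :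
    degreeProj d n x ∈ (homogeneousSubmodule (Fin d) ℂ n).map (incl d) := by
  refine induction_on_incl
    (P := fun x => degreeProj d n x ∈ (homogeneousSubmodule (Fin d) ℂ n).map (incl d)) x
    ((isClosed_map_incl _).preimage (degreeProj d n).continuous) fun f => ?_
  rw [degreeProj_incl]
  exact Submodule.mem_map_of_mem (homogeneousComponent_mem n f)

/-- The inclusion of `Poly d` in `H²_d`. -/
noncomputable abbrev polyIncl (d : ℕ) : Poly d →ₗ[ℂ] Space d :=
  (UniformSpace.Completion.toComplL (𝕜 := ℂ) (E := Poly d)).toLinearMap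

instance finiteDimensional_degreePart (n : ℕ) : FiniteDimensional ℂ (degreePart I n) :=
  Submodule.finiteDimensional_of_le (S₂ := (homogeneousSubmodule (Fin d) ℂ n).map
    (toPoly d).toLinearMap) inf_le_left

theorem degreeProj_mem_map_degreePart (hI : IsHomogeneousIdeal I) (n : ℕ) {x : Space d}
    (hx : x ∈ quotientModule I) : degreeProj d n x ∈ (degreePart I n).map (polyIncl d) := by
  obtain ⟨f, hf, hfx⟩ := degreeProj_mem_map n x
  have hmem := degreeProj_mem_quotientModule hI n hx
  refine ⟨toPoly d f, ⟨Submodule.mem_map_of_mem hf, ?_⟩, hfx⟩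
  rw [SetLike.mem_coe, Submodule.mem_orthogonal]
  rintro _ ⟨g, hg, rfl⟩
  rw [← hfx, mem_quotientModule_iff] at hmem
  have := hmem g hg.1
  rwa [inner_incl] at this

theorem rank_degreeProj_comp_subtypeL_le (hI : IsHomogeneousIdeal I) (n : ℕ) :
    (degreeProj d n ∘L (quotientModule I).subtypeL).toLinearMap.rank ≤
      Module.finrank ℂ (degreePart I n) := by
  have hle : LinearMap.range (degreeProj d n ∘L (quotientModule I).subtypeL).toLinearMap ≤
      (degreePart I n).map (polyIncl d) := by
    rintro _ ⟨x, rfl⟩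
    exact degreeProj_mem_map_degreePart hI n x.2
  rw [Module.finrank_eq_rank]
  exact (Submodule.rank_mono hle).trans (rank_map_le _ _)

/-- For a polynomial `f` of degree below `N`, the degrees below `N` contribute nothing to `⟨x, y⟩`,
and the tail of `x` is the tail of `x - f`. Now let `f` tend to `x`. -/
theorem inner_eq_zero_of_degreeProj {x y : Space d}
    (h : ∀ n, inner ℂ (degreeProj d n x) y = 0) : inner ℂ x y = 0 := by
  have key : ∀ f : MvPolynomial (Fin d) ℂ, ‖inner ℂ x y‖ ≤ ‖x - incl d f‖ * ‖y‖ := fun f => by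
    set N := f.totalDegree + 1
    have hx : x = ∑ n ∈ Finset.range N, degreeProj d n x + tailProj d N x := by
      have := DFunLike.congr_fun (sum_degreeProj_add_tailProj (d := d) N) x
      rw [add_apply, sum_apply] at this
      exact this.symm
    have h1 : inner ℂ x y = inner ℂ (tailProj d N (x - incl d f)) y := by
      rw [map_sub, tailProj_incl_of_totalDegree_lt (Nat.lt_succ_self _), sub_zero]
      conv_lhs => rw [hx]
      rw [inner_add_left, sum_inner, Finset.sum_eq_zero fun n _ => h n, zero_add]
    rw [h1]
    refine (norm_inner_le_norm _ _).trans (mul_le_mul_of_nonneg_right ?_ (norm_nonneg _))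
    exact (norm_diagonal_apply_le _ _).trans_eq (one_mul _)
  have hall := induction_on_incl (P := fun z => ‖inner ℂ x y‖ ≤ ‖x - z‖ * ‖y‖) x
    (isClosed_le (by fun_prop) (by fun_prop)) key
  rw [sub_self, norm_zero, zero_mul] at hall
  exact norm_le_zero_iff.mp hall

/-- Each homogeneous component of an element of the closure of `I` lies in `I`. -/
theorem exists_mem_of_mem_quotientModule_orthogonal (hI : IsHomogeneousIdeal I) (n : ℕ)
    {x : Space d} (hx : x ∈ (quotientModule I)ᗮ) : ∃ f ∈ I, degreeProj d n x = incl d f := by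
  rw [Submodule.orthogonal_orthogonal_eq_closure] at hx
  let U := I.restrictScalars ℂ ⊓ homogeneousSubmodule (Fin d) ℂ n
  have : FiniteDimensional ℂ U := Submodule.finiteDimensional_of_le inf_le_right
  -- The degree-`n` part of `I` is finite-dimensional, hence closed, so taking the closure adds
  -- nothing in degree `n`.
  have hsub : closure ((I.restrictScalars ℂ).map (incl d) : Set (Space d)) ⊆
      degreeProj d n ⁻¹' (U.map (incl d)) := by
    refine closure_minimal ?_ ((isClosed_map_incl U).preimage (degreeProj d n).continuous)
    rintro _ ⟨f, hf, rfl⟩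
    rw [Set.mem_preimage, degreeProj_incl]
    exact Submodule.mem_map_of_mem
      ⟨hI.homogeneousComponent_mem n hf, homogeneousComponent_mem n f⟩
  obtain ⟨f, hf, hfx⟩ := hsub hx
  exact ⟨f, hf.1, hfx.symm⟩

/-- A vector orthogonal to all the `𝓕_{I_j}` lies in the closure of every `I_j`. Closures of ideals
could intersect in more than the closure of the intersection; homogeneity excludes this, since each
homogeneous component is one polynomial lying in every `I_j`. -/
theorem quotientModule_iInf {ι : Type*} (i₀ : ι) {I : ι → Ideal (MvPolynomial (Fin d) ℂ)}
    (hI : ∀ j, IsHomogeneousIdeal (I j))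
    (h : IsClosed ((⨆ j, quotientModule (I j) : Submodule ℂ (Space d)) : Set (Space d))) :
    quotientModule (⨅ j, I j) = ⨆ j, quotientModule (I j) := by
  refine le_antisymm (fun y hy => ?_)
    (iSup_le fun j => quotientModule_antitone (iInf_le I j))
  have hcl : (⨆ j, quotientModule (I j))ᗮᗮ = ⨆ j, quotientModule (I j) := by
    rw [Submodule.orthogonal_orthogonal_eq_closure, h.submodule_topologicalClosure_eq]
  rw [← hcl, Submodule.mem_orthogonal]
  intro x hx
  refine inner_eq_zero_of_degreeProj fun n => ?_
  have hxj : ∀ j, x ∈ (quotientModule (I j))ᗮ := fun j =>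
    Submodule.orthogonal_le (le_iSup (fun j => quotientModule (I j)) j) hx
  choose f hf hfx using fun j => exists_mem_of_mem_quotientModule_orthogonal (hI j) n (hxj j)
  have hmem : f i₀ ∈ ⨅ j, I j := by
    rw [Submodule.mem_iInf]
    intro j
    rw [incl_injective ((hfx i₀).symm.trans (hfx j))]
    exact hf j
  rw [hfx i₀]
  exact mem_quotientModule_iff.mp hy _ hmem

theorem isHomogeneousIdeal_iInf {ι : Type*} {I : ι → Ideal (MvPolynomial (Fin d) ℂ)}
    (hI : ∀ j, IsHomogeneousIdeal (I j)) : IsHomogeneousIdeal (⨅ j, I j) :=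
  Ideal.IsHomogeneous.iInf hI

/-! ### The dimension condition -/

theorem rank_sum_degreeProj_le (hI : IsHomogeneousIdeal I) (N : ℕ) :
    ((∑ n ∈ Finset.range N, degreeProj d n) ∘L (quotientModule I).subtypeL).toLinearMap.rank ≤
      (∑ n ∈ Finset.range N, Module.finrank ℂ (degreePart I n) : ℕ) := by
  have : ((∑ n ∈ Finset.range N, degreeProj d n) ∘L (quotientModule I).subtypeL).toLinearMap =
      ∑ n ∈ Finset.range N, (degreeProj d n ∘L (quotientModule I).subtypeL).toLinearMap := by
    ext x
    simp
  rw [this, Nat.cast_sum]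
  exact (LinearMap.rank_finsetSum_le _ _).trans
    (Finset.sum_le_sum fun n _ => rank_degreeProj_comp_subtypeL_le hI n)

/-- The approximant first truncates to degrees below `N`, which bounds its rank; the error acts on
the tail. -/
theorem singularNumber_compression_shiftCommutator_le (hI : IsHomogeneousIdeal I) (i j : Fin d)
    {N m : ℕ} (hm : ∑ n ∈ Finset.range N, Module.finrank ℂ (degreePart I n) ≤ m) :
    singularNumber (compression (quotientModule I) (shiftCommutator i j)) m ≤
      2 / ((N : ℝ) + 1) := by
  set U := quotientModule I
  set R : U →L[ℂ] Space d := (∑ n ∈ Finset.range N, degreeProj d n) ∘L U.subtypeL with hR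
  refine (singularNumber_antitone _ hm).trans ((singularNumber_le_norm_sub _
    ((U.orthogonalProjectionOnto ∘L shiftCommutator i j) ∘L R) ?_).trans ?_)
  · exact (LinearMap.rank_comp_le_right R.toLinearMap
      (U.orthogonalProjectionOnto ∘L shiftCommutator i j).toLinearMap).trans
      (rank_sum_degreeProj_le hI N)
  · refine opNorm_le_bound _ (by positivity) fun x => ?_
    have hx : (x : Space d) - R x = tailProj d N x := by
      have := DFunLike.congr_fun (sum_degreeProj_add_tailProj (d := d) N) (x : Space d)
      exact sub_eq_of_eq_add' this.symm
    have : (compression U (shiftCommutator i j) -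
        (U.orthogonalProjectionOnto ∘L shiftCommutator i j) ∘L R) x =
        U.orthogonalProjectionOnto (shiftCommutator i j (tailProj d N x)) := by
      rw [← hx, map_sub, map_sub]
      rfl
    rw [this]
    exact (Submodule.norm_orthogonalProjectionOnto_apply_le _ _).trans
      (norm_shiftCommutator_tailProj_le i j N x)

end Ideals

/-! ### Growth of the Hilbert function and the off-diagonal criterion -/

section Main

open MvPolynomial ContinuousLinearMap

variable {d : ℕ} {I : Ideal (MvPolynomial (Fin d) ℂ)}

theorem exists_eval_le (h : Polynomial ℚ) :
    ∃ C : ℝ, 0 < C ∧ ∀ n : ℕ, ((h.eval (n : ℚ) : ℚ) : ℝ) ≤ C * ((n : ℝ) + 1) ^ h.natDegree := by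
  refine ⟨∑ i ∈ Finset.range (h.natDegree + 1), |((h.coeff i : ℚ) : ℝ)| + 1,
    add_pos_of_nonneg_of_pos (Finset.sum_nonneg fun _ _ => abs_nonneg _) one_pos, fun n => ?_⟩
  have hn : (1 : ℝ) ≤ (n : ℝ) + 1 := by linarith [n.cast_nonneg (α := ℝ)]
  rw [Polynomial.eval_eq_sum_range, add_mul, Finset.sum_mul]
  push_cast
  refine (Finset.sum_le_sum fun i hi => ?_).trans (le_add_of_nonneg_right (by positivity))
  have hi' : i ≤ h.natDegree := Nat.lt_succ_iff.mp (Finset.mem_range.mp hi)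
  calc (h.coeff i : ℝ) * (n : ℝ) ^ i ≤ |(h.coeff i : ℝ)| * ((n : ℝ) + 1) ^ i := by
        gcongr
        · exact le_abs_self _
        · linarith
    _ ≤ |(h.coeff i : ℝ)| * ((n : ℝ) + 1) ^ h.natDegree := by gcongr

/-- A sequence of natural numbers that is eventually bounded by `C * (n + 1) ^ e` has partial sums
bounded by a multiple of `(N + 1) ^ (e + 1)`. -/
theorem exists_sum_le {a : ℕ → ℕ} {C : ℝ} (hC : 0 < C) {e : ℕ}
    (h : ∀ᶠ n in Filter.atTop, (a n : ℝ) ≤ C * ((n : ℝ) + 1) ^ e) :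
    ∃ B : ℝ, 0 < B ∧ ∀ N : ℕ, ((∑ n ∈ Finset.range N, a n : ℕ) : ℝ) ≤
      B * ((N : ℝ) + 1) ^ (e + 1) := by
  obtain ⟨n₀, hn₀⟩ := Filter.eventually_atTop.mp h
  have hS : (0 : ℝ) ≤ ∑ n ∈ Finset.range n₀, (a n : ℝ) :=
    Finset.sum_nonneg fun _ _ => Nat.cast_nonneg _
  -- The initial values, which the eventual bound misses, are absorbed into the constant.
  refine ⟨C + ∑ n ∈ Finset.range n₀, (a n : ℝ), by positivity, fun N => ?_⟩
  have hall : ∀ n, (a n : ℝ) ≤ (C + ∑ n ∈ Finset.range n₀, (a n : ℝ)) * ((n : ℝ) + 1) ^ e := by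
    intro n
    have hn : (1 : ℝ) ≤ ((n : ℝ) + 1) ^ e :=
      one_le_pow₀ (by linarith [n.cast_nonneg (α := ℝ)])
    rcases lt_or_ge n n₀ with hlt | hge
    · have := Finset.single_le_sum (f := fun n => (a n : ℝ)) (fun _ _ => Nat.cast_nonneg _)
        (Finset.mem_range.mpr hlt)
      nlinarith
    · have := hn₀ n hge
      nlinarith
  have hCS : 0 ≤ C + ∑ n ∈ Finset.range n₀, (a n : ℝ) := by positivity
  push_cast
  calc ∑ n ∈ Finset.range N, (a n : ℝ)
      ≤ ∑ _n ∈ Finset.range N, (C + ∑ n ∈ Finset.range n₀, (a n : ℝ)) * ((N : ℝ) + 1) ^ e := by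
        refine Finset.sum_le_sum fun n hn => (hall n).trans ?_
        have : (n : ℝ) ≤ N := by exact_mod_cast (Finset.mem_range.mp hn).le
        gcongr
    _ = (N : ℝ) * ((C + ∑ n ∈ Finset.range n₀, (a n : ℝ)) * ((N : ℝ) + 1) ^ e) := by
        rw [Finset.sum_const, Finset.card_range, nsmul_eq_mul]
    _ ≤ ((N : ℝ) + 1) * ((C + ∑ n ∈ Finset.range n₀, (a n : ℝ)) * ((N : ℝ) + 1) ^ e) := by
        gcongr
        linarith
    _ = _ := by ring

/-- If `dim I < p`, then the dimensions of the graded pieces of `𝓕_I` have partial sums of growth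
order less than `p`. -/
theorem exists_sum_finrank_le {p : ℝ} (hp : 1 ≤ p)
    (hdim : ((idealDim I : ℕ∞) : ℝ≥0∞) < ENNReal.ofReal p) :
    ∃ D C : ℝ, 0 < D ∧ D < p ∧ 0 < C ∧ ∀ N : ℕ,
      ((∑ n ∈ Finset.range N, Module.finrank ℂ (degreePart I n) : ℕ) : ℝ) ≤
        C * ((N : ℝ) + 1) ^ D := by
  obtain ⟨h, hh, hlt⟩ : ∃ h : Polynomial ℚ, IsHilbertPolynomial I h ∧
      (((if h = 0 then 0 else (h.natDegree : ℕ∞) + 1 : ℕ∞)) : ℝ≥0∞) < ENNReal.ofReal p := by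
    -- If no Hilbert polynomial had value below `p`, all values would be at least `idealDim I + 1`,
    -- and so would their infimum. If there were no Hilbert polynomial, the infimum would be `⊤`,
    -- against `hdim`.
    by_contra! hcon
    have hne : idealDim I ≠ ⊤ := fun htop => by
      rw [htop] at hdim
      simp at hdim
    obtain ⟨m, hm⟩ := ENat.ne_top_iff_exists.mp hne
    have hle : ((m + 1 : ℕ) : ℕ∞) ≤ idealDim I := by
      refine le_iInf₂ fun h hh => ?_
      have h1 := hdim.trans_le (hcon h hh)
      rw [ENat.toENNReal_lt, ← hm] at h1
      push_cast
      exact Order.add_one_le_of_lt h1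
    rw [← hm] at hle
    exact absurd (Nat.cast_le.mp hle) (by omega)
  by_cases h0 : h = 0
  -- The partial sums are bounded, but the exponent must be positive and below `p`; any number in
  -- `(0, 1)` serves.
  · refine ⟨1 / 2, ?_⟩
    have hev : ∀ᶠ n in Filter.atTop, Module.finrank ℂ (degreePart I n) = 0 := by
      filter_upwards [hh] with n hn
      rw [h0, Polynomial.eval_zero] at hn
      exact_mod_cast hn.symm
    obtain ⟨n₀, hn₀⟩ := Filter.eventually_atTop.mp hev
    set B : ℝ := ((∑ n ∈ Finset.range n₀, Module.finrank ℂ (degreePart I n) : ℕ) : ℝ) with hB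
    refine ⟨B + 1, by norm_num, by linarith, by positivity, fun N => ?_⟩
    have hle : ∑ n ∈ Finset.range N, Module.finrank ℂ (degreePart I n) ≤
        ∑ n ∈ Finset.range n₀, Module.finrank ℂ (degreePart I n) := by
      refine Finset.sum_le_sum_of_ne_zero fun n _ hne => Finset.mem_range.mpr ?_
      by_contra hcon
      exact hne (hn₀ n (not_lt.mp hcon))
    have h1 : (1 : ℝ) ≤ ((N : ℝ) + 1) ^ (1 / 2 : ℝ) :=
      Real.one_le_rpow (by linarith [N.cast_nonneg (α := ℝ)]) (by norm_num)
    have h2 : ((∑ n ∈ Finset.range N, Module.finrank ℂ (degreePart I n) : ℕ) : ℝ) ≤ B :=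
      Nat.cast_le.mpr hle
    have h3 : 0 ≤ B := Nat.cast_nonneg _
    nlinarith
  · rw [if_neg h0] at hlt
    obtain ⟨C, hC, hCn⟩ := exists_eval_le h
    obtain ⟨B, hB, hBN⟩ := exists_sum_le hC (e := h.natDegree)
      (a := fun n => Module.finrank ℂ (degreePart I n)) (by
        filter_upwards [hh] with n hn
        have := hCn n
        rw [hn] at this
        exact_mod_cast this)
    refine ⟨((h.natDegree + 1 : ℕ) : ℝ), B, by positivity, ?_, hB, fun N => ?_⟩
    · have e : ((((h.natDegree : ℕ∞) + 1 : ℕ∞)) : ℝ≥0∞) =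
          ENNReal.ofReal ((h.natDegree + 1 : ℕ) : ℝ) := by
        rw [ENNReal.ofReal_natCast]
        push_cast
        simp
      rw [e] at hlt
      exact (ENNReal.ofReal_lt_ofReal_iff (by linarith)).mp hlt
    · rw [Real.rpow_natCast]
      exact hBN N

theorem isSchatten_compression_shiftCommutator (hI : IsHomogeneousIdeal I) {p : ℝ} (hp : 1 ≤ p)
    (hdim : ((idealDim I : ℕ∞) : ℝ≥0∞) < ENNReal.ofReal p) (i j : Fin d) :
    IsSchatten p (compression (quotientModule I) (shiftCommutator i j)) := by
  obtain ⟨D, C, hD, hDp, hC, hN⟩ := exists_sum_finrank_le hp hdim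
  exact isSchatten_of_polynomial_growth hD hDp hC zero_le_two fun N m hm =>
    singularNumber_compression_shiftCommutator_le hI i j (Nat.cast_le.mp ((hN N).trans hm))

/-- Essential normality in terms of the off-diagonal parts of the shifts. -/
theorem isEssentiallyNormal_iff {p : ℝ} (hp : 1 ≤ p)
    (hK : ∀ i j, IsSchatten p (compression (quotientModule I) (shiftCommutator i j))) :
    IsEssentiallyNormal p I ↔
      ∀ i, IsSchatten (2 * p) (offDiagonal (quotientModule I) (shift i)) := by
  have hp0 : 0 ≤ p := zero_le_one.trans hp
  have key : ∀ i j, compressedShift I i ∘L adjoint (compressedShift I j) -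
      adjoint (compressedShift I j) ∘L compressedShift I i =
      compression (quotientModule I) (shiftCommutator i j) +
        adjoint (offDiagonal (quotientModule I) (shift j)) ∘L
          offDiagonal (quotientModule I) (shift i) := fun i j =>
    commutator_compression_eq _ _ fun _ hx => adjoint_shift_mem_quotientModule j hx
  -- The case `i = j` suffices: it gives `X_i^* X_i ∈ 𝓛^p`, hence `X_i ∈ 𝓛^{2p}`.
  refine ⟨fun h i => IsSchatten.of_adjoint_comp_self hp0 ?_, fun h i j => ?_⟩
  · have := (h i i).sub hp (hK i i)
    rwa [key, add_sub_cancel_left] at this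
  · rw [key]
    exact (hK i j).add hp
      (((h j).adjoint (mul_nonneg zero_le_two hp0)).comp_of_two_mul hp0 (h i))

end Main

end DruryArveson

theorem mainTheorem6 {d k : ℕ} (hk : 1 ≤ k)
    (I : Fin k → Ideal (MvPolynomial (Fin d) ℂ))
    (hI : ∀ j, DruryArveson.IsHomogeneousIdeal (I j))
    (p : ℝ) (hp : 1 ≤ p) :
    (((⨆ j, DruryArveson.idealDim (I j) : ℕ∞) : ℝ≥0∞) < ENNReal.ofReal p →
      (∀ j, DruryArveson.IsEssentiallyNormal p (I j)) →
      IsClosed ((⨆ j, (DruryArveson.quotientModule (I j))ᗮ :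
        Submodule ℂ (DruryArveson.Space d)) : Set (DruryArveson.Space d)) →
      DruryArveson.IsEssentiallyNormal p (⨆ j, I j)) ∧
    ((DruryArveson.idealDim (⨅ j, I j) : ℝ≥0∞) < ENNReal.ofReal p →
      (∀ j, DruryArveson.IsEssentiallyNormal p (I j)) →
      IsClosed ((⨆ j, DruryArveson.quotientModule (I j) :
        Submodule ℂ (DruryArveson.Space d)) : Set (DruryArveson.Space d)) →
      DruryArveson.IsEssentiallyNormal p (⨅ j, I j)) := by
  open DruryArveson in
  have hp2 : 1 ≤ 2 * p := by linarith
  refine ⟨fun hdim hess hcl => ?_, fun hdim hess hcl => ?_⟩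
  · have hK : ∀ j a b, IsSchatten p (compression (quotientModule (I j)) (shiftCommutator a b)) :=
      fun j => isSchatten_compression_shiftCommutator (hI j) hp
        ((ENat.toENNReal_le.mpr (le_iSup (fun j => idealDim (I j)) j)).trans_lt hdim)
    -- No separate dimension bound for the sum is needed: its `𝓕` lies in that of one `I j`, which
    -- exists as `k ≥ 1`, and inherits the commutator estimate.
    have hle : quotientModule (⨆ j, I j) ≤ quotientModule (I ⟨0, hk⟩) :=
      quotientModule_antitone (le_iSup I _)
    rw [isEssentiallyNormal_iff hp fun a b => isSchatten_compression_of_le hp hle (hK _ a b)]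
    exact fun i => isSchatten_offDiagonal_of_isClosed_iSup_orthogonal hp2
      (fun j => quotientModule (I j)) (quotientModule_iSup I) hcl _
      fun j => (isEssentiallyNormal_iff hp (hK j)).mp (hess j) i
  -- Here the inheritance runs from the intersection, whose `𝓕` is the largest, down to each `I j`.
  · have hK := isSchatten_compression_shiftCommutator (isHomogeneousIdeal_iInf hI) hp hdim
    rw [isEssentiallyNormal_iff hp hK]
    exact fun i => isSchatten_offDiagonal_of_isClosed_iSup hp2
      (fun j => quotientModule (I j)) (quotientModule_iInf ⟨0, hk⟩ hI hcl) hcl _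
      fun j => (isEssentiallyNormal_iff hp fun a b => isSchatten_compression_of_le hp
        (quotientModule_antitone (iInf_le I j)) (hK a b)).mp (hess j) i
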